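/- A Young diagram is a finite left-justified arrangement of cells in rows whose lengths weakly decrease from top to bottom (with no empty rows or columns). A \emph{tree-like tableau} is a filling of some cells of a non-empty Young diagram with points such that (1) the top left cell contains a point, called the root point; (2) for every non-root pointed cell $c$ there is either a pointed cell above $c$ in the same column or a pointed cell to the left of $c$ in the same row, but not both; (3) every row and every column contains at least one pointed cell. The \emph{size} of a tree-like tableau is its number of points, and $\mathcal{T}_n$ denotes the set of tree-like tableaux of size $n$. A \emph{corner} of a tableau is a cell of its diagram with no cell of the diagram directly below it and none directly to its right; it is \emph{non-occupied} if it contains no point. Then the total number of non-occupied corners, summed over all tableaux $T\in\mathcal{T}_n$, is finite and equal to $$n!\cdot\frac{n-2}{6}\quad\text{for } n\ge 3,$$ and it is $0$ for $n=1$ and $n=2$. -/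

import Mathlib

open scoped Nat

/-- A tree-like tableau: a Young diagram (a left-justified arrangement of cells whose rows weakly
decrease in length from top to bottom, here without empty rows or columns), some of whose cells
contain a point, subject to three rules. The cell `(i, j)` lies in row `i` (counted downward from
`0`) and column `j` (counted rightward from `0`). Thus row `i` (column `j`) belongs to the diagram
exactly when it contains some cell of the diagram. -/
@[ext]
structure TreeLikeTableau where
  /-- The underlying diagram. -/
  diagram : YoungDiagram
  /-- The pointed cells. -/
  points : Finset (ℕ × ℕ)
  /-- Points are placed in cells of the diagram. -/
  points_subset : points ⊆ diagram.cells
  /-- The top left cell contains a point, the root point. -/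
  root_mem : (0, 0) ∈ points
  /-- Every non-root pointed cell has either a pointed cell above it in its column, or a pointed
  cell to its left in its row, but not both. -/
  above_xor_left : ∀ i j : ℕ, (i, j) ∈ points → (i, j) ≠ (0, 0) →
    Xor (∃ i' < i, (i', j) ∈ points) (∃ j' < j, (i, j') ∈ points)
  /-- Every row of the diagram possesses at least one pointed cell. -/
  row_pointed : ∀ i j : ℕ, (i, j) ∈ diagram → ∃ j', (i, j') ∈ points
  /-- Every column of the diagram possesses at least one pointed cell. -/
  col_pointed : ∀ i j : ℕ, (i, j) ∈ diagram → ∃ i', (i', j) ∈ points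

namespace TreeLikeTableau

/-- The size of a tree-like tableau is its number of points. -/
def size (T : TreeLikeTableau) : ℕ := T.points.card

/-- The set of all tree-like tableaux of size `n`. -/
def ofSize (n : ℕ) : Set TreeLikeTableau := {T | T.size = n}

/-- A corner is a cell of the diagram whose bottom and right edges are border edges, that is,
with no cell of the diagram directly below it or directly to its right. -/
def IsCorner (T : TreeLikeTableau) (c : ℕ × ℕ) : Prop :=
  c ∈ T.diagram ∧ (c.1 + 1, c.2) ∉ T.diagram ∧ (c.1, c.2 + 1) ∉ T.diagram

/-- A non-occupied corner is a corner that contains no point. -/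
def IsNonOccupiedCorner (T : TreeLikeTableau) (c : ℕ × ℕ) : Prop :=
  T.IsCorner c ∧ c ∉ T.points

/-- The non-occupied corners of the tableaux in a set `X`. A corner is recorded together with its
tableau, so that corners of different tableaux are different. -/
def nonOccupiedCorners (X : Set TreeLikeTableau) : Set (TreeLikeTableau × (ℕ × ℕ)) :=
  {p | p.1 ∈ X ∧ p.1.IsNonOccupiedCorner p.2}

end TreeLikeTableau

/-! Encode a Young diagram by its border path, read from bottom left to top right, with a letter D
(`true`) for each column and E (`false`) for each row. Column and row meet in a cell exactly when D
precedes E, and corners are the factors DE. In a tableau a corner other than the root is empty, or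
has a point to its left and is alone in its column, or has a point above it and is alone in its row.
Deleting the cell, the column or the row gives the exclusion-process relation DE = ED + D + E for
the number of tableaux with a given border word (`Board.IsCorner.count_eq`,
`wordBoard.innerCount_append`). Write the border word as D w E. An initial E or a final D of w can
be dropped, so the count is a matrix product ⟨W|w|V⟩ with ⟨W|E = ⟨W|, D|V⟩ = |V⟩ and ⟨W|V⟩ = 1.

Tableaux with a marked empty corner correspond to fillings in which the factor DE is replaced by ED.
A tableau of size n has border length n + 1. With m = n - 3, the total is therefore the sum of
⟨W|S^i ED S^j|V⟩ over i + j = m, where S = D + E. The relation implies D S^k = S^k (D + k) and E S^k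
= S^k (E - k). Moving the powers of S to the left and using the boundary vectors gives (m+1)!
(j+1)(m+1-j) for each term (`exclusionModule.total_pow_shift_shift`). Summing over j gives (m+1)!
times the binomial coefficient of m+3 over 3, that is n! (n-2)/6. -/

/-- A board: finite sets of row and column indices with the relations "lies above" and
"lies to the left of", the cells where a row and a column meet, and a root cell. -/
structure Board where
  rows : Finset ℕ
  cols : Finset ℕ
  above : ℕ → ℕ → Prop
  left : ℕ → ℕ → Prop
  cell : ℕ → ℕ → Prop
  root : ℕ × ℕ

/-! ### Fillings of abstract boards and the recursion at a corner -/

namespace Board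

/-- The rules of tree-like tableaux, on an arbitrary board. -/
structure IsFilling (B : Board) (P : Finset (ℕ × ℕ)) : Prop where
  mem : ∀ i j, (i, j) ∈ P → i ∈ B.rows ∧ j ∈ B.cols ∧ B.cell i j
  root : B.root ∈ P
  xor : ∀ i j, (i, j) ∈ P → (i, j) ≠ B.root →
    Xor (∃ i', B.above i' i ∧ (i', j) ∈ P) (∃ j', B.left j' j ∧ (i, j') ∈ P)
  row : ∀ i ∈ B.rows, ∃ j, (i, j) ∈ P
  col : ∀ j ∈ B.cols, ∃ i, (i, j) ∈ P

/-- The set of fillings of a board. -/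
def fillings (B : Board) : Set (Finset (ℕ × ℕ)) := {P | B.IsFilling P}

/-- The number of fillings of a board. -/
noncomputable def count (B : Board) : ℕ := B.fillings.ncard

theorem finite_fillings (B : Board) : B.fillings.Finite := by
  refine (Finset.finite_toSet (B.rows ×ˢ B.cols).powerset).subset fun P hP => ?_
  simp only [Finset.coe_powerset, Set.mem_preimage, Set.mem_powerset_iff]
  rintro ⟨i, j⟩ hx
  have := hP.mem i j hx
  simp [this.1, this.2.1]

theorem IsFilling.root_mem {B : Board} {P : Finset (ℕ × ℕ)} (h : B.IsFilling P) :
    B.root.1 ∈ B.rows ∧ B.root.2 ∈ B.cols ∧ B.cell B.root.1 B.root.2 := h.mem _ _ h.root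

/-- An embedding of boards that is bijective on rows and on columns. -/
structure Iso (B B' : Board) (e f : ℕ → ℕ) : Prop where
  rows : Set.BijOn e B.rows B'.rows
  cols : Set.BijOn f B.cols B'.cols
  above : ∀ i ∈ B.rows, ∀ i' ∈ B.rows, (B.above i i' ↔ B'.above (e i) (e i'))
  left : ∀ j ∈ B.cols, ∀ j' ∈ B.cols, (B.left j j' ↔ B'.left (f j) (f j'))
  cell : ∀ i ∈ B.rows, ∀ j ∈ B.cols, (B.cell i j ↔ B'.cell (e i) (f j))
  root : B'.root = (e B.root.1, f B.root.2)

theorem Iso.symm {B B' : Board} {e f : ℕ → ℕ} (h : Iso B B' e f)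
    (hr : B.root.1 ∈ B.rows) (hc : B.root.2 ∈ B.cols) :
    Iso B' B (Function.invFunOn e B.rows) (Function.invFunOn f B.cols) := by
  have he := h.rows.invOn_invFunOn
  have hf := h.cols.invOn_invFunOn
  have he' : Set.BijOn (Function.invFunOn e B.rows) B'.rows B.rows :=
    Set.BijOn.symm he.symm h.rows
  have hf' : Set.BijOn (Function.invFunOn f B.cols) B'.cols B.cols :=
    Set.BijOn.symm hf.symm h.cols
  refine ⟨he', hf', ?_, ?_, ?_, ?_⟩
  · intro i hi i' hi'
    rw [h.above _ (he'.mapsTo hi) _ (he'.mapsTo hi'), he.2 hi, he.2 hi']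
  · intro i hi i' hi'
    rw [h.left _ (hf'.mapsTo hi) _ (hf'.mapsTo hi'), hf.2 hi, hf.2 hi']
  · intro i hi i' hi'
    rw [h.cell _ (he'.mapsTo hi) _ (hf'.mapsTo hi'), he.2 hi, hf.2 hi']
  · rw [h.root, he.1 hr, hf.1 hc]

theorem Iso.isFilling {B B' : Board} {e f : ℕ → ℕ} (h : Iso B B' e f) {P : Finset (ℕ × ℕ)}
    (hP : B.IsFilling P) : B'.IsFilling (P.image (Prod.map e f)) := by
  have key : ∀ i ∈ B.rows, ∀ j ∈ B.cols, (e i, f j) ∈ P.image (Prod.map e f) → (i, j) ∈ P := by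
    intro i hi j hj hm
    simp only [Finset.mem_image, Prod.exists, Prod.map_apply, Prod.mk.injEq] at hm
    obtain ⟨a, b, hab, h1, h2⟩ := hm
    have hm := hP.mem _ _ hab
    rw [← h.rows.injOn hm.1 hi h1, ← h.cols.injOn hm.2.1 hj h2]
    exact hab
  have key' : ∀ i j, (i, j) ∈ P → (e i, f j) ∈ P.image (Prod.map e f) := fun i j hij =>
    Finset.mem_image.2 ⟨(i, j), hij, rfl⟩
  have ex : ∀ x y, (x, y) ∈ P.image (Prod.map e f) → ∃ i j, (i, j) ∈ P ∧ x = e i ∧ y = f j := by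
    intro x y hm
    simp only [Finset.mem_image, Prod.exists, Prod.map_apply, Prod.mk.injEq] at hm
    obtain ⟨a, b, hab, h1, h2⟩ := hm
    exact ⟨a, b, hab, h1.symm, h2.symm⟩
  refine ⟨?_, ?_, ?_, ?_, ?_⟩
  · intro x y hxy
    obtain ⟨i, j, hij, rfl, rfl⟩ := ex x y hxy
    have hm := hP.mem _ _ hij
    exact ⟨h.rows.mapsTo hm.1, h.cols.mapsTo hm.2.1, (h.cell _ hm.1 _ hm.2.1).1 hm.2.2⟩
  · rw [h.root]
    exact key' _ _ hP.root
  · intro x y hxy hne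
    obtain ⟨i, j, hij, rfl, rfl⟩ := ex x y hxy
    have hm := hP.mem _ _ hij
    have hne' : (i, j) ≠ B.root := by
      rintro h0
      apply hne
      rw [h.root, ← h0]
    have h1 : (∃ i', B'.above i' (e i) ∧ (i', f j) ∈ P.image (Prod.map e f)) ↔
        ∃ i', B.above i' i ∧ (i', j) ∈ P := by
      constructor
      · rintro ⟨x', hx', hm'⟩
        obtain ⟨a, b, hab, rfl, hb⟩ := ex _ _ hm'
        have hm2 := hP.mem _ _ hab
        exact ⟨a, (h.above _ hm2.1 _ hm.1).2 hx', key _ hm2.1 _ hm.2.1 hm'⟩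
      · rintro ⟨a, ha, hm'⟩
        exact ⟨e a, (h.above _ (hP.mem _ _ hm').1 _ hm.1).1 ha, key' _ _ hm'⟩
    have h2 : (∃ j', B'.left j' (f j) ∧ (e i, j') ∈ P.image (Prod.map e f)) ↔
        ∃ j', B.left j' j ∧ (i, j') ∈ P := by
      constructor
      · rintro ⟨x', hx', hm'⟩
        obtain ⟨a, b, hab, ha, rfl⟩ := ex _ _ hm'
        have hm2 := hP.mem _ _ hab
        exact ⟨b, (h.left _ hm2.2.1 _ hm.2.1).2 hx', key _ hm.1 _ hm2.2.1 hm'⟩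
      · rintro ⟨a, ha, hm'⟩
        exact ⟨f a, (h.left _ (hP.mem _ _ hm').2.1 _ hm.2.1).1 ha, key' _ _ hm'⟩
    rw [h1, h2]
    exact hP.xor i j hij hne'
  · intro x hx
    obtain ⟨i, hi, rfl⟩ := h.rows.surjOn hx
    obtain ⟨j, hj⟩ := hP.row i hi
    exact ⟨_, key' _ _ hj⟩
  · intro x hx
    obtain ⟨i, hi, rfl⟩ := h.cols.surjOn hx
    obtain ⟨j, hj⟩ := hP.col i hi
    exact ⟨_, key' _ _ hj⟩

theorem image_prodMap_leftInvOn {A B : Finset ℕ} {e e' f f' : ℕ → ℕ} (he : Set.LeftInvOn e' e A)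
    (hf : Set.LeftInvOn f' f B) {P : Finset (ℕ × ℕ)} (hP : ∀ i j, (i, j) ∈ P → i ∈ A ∧ j ∈ B) :
    (P.image (Prod.map e f)).image (Prod.map e' f') = P := by
  rw [Finset.image_image]
  conv_rhs => rw [← Finset.image_id (s := P)]
  apply Finset.image_congr
  rintro ⟨i, j⟩ hij
  have := hP i j hij
  simp [he this.1, hf this.2]

theorem Iso.count_eq {B B' : Board} {e f : ℕ → ℕ} (h : Iso B B' e f)
    (hr : B.root.1 ∈ B.rows) (hc : B.root.2 ∈ B.cols) : B.count = B'.count := by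
  refine Set.BijOn.ncard_eq (f := fun P => P.image (Prod.map e f)) ?_
  have hs := h.symm hr hc
  refine Set.BijOn.mk (fun P hP => h.isFilling hP) ?_ ?_
  · refine Set.LeftInvOn.injOn (f₁' := fun P => P.image (Prod.map (Function.invFunOn e B.rows)
      (Function.invFunOn f B.cols))) fun P hP => ?_
    exact image_prodMap_leftInvOn h.rows.invOn_invFunOn.1 h.cols.invOn_invFunOn.1
      fun i j hij => ⟨(hP.mem i j hij).1, (hP.mem i j hij).2.1⟩
  · refine fun P hP => ⟨_, hs.isFilling hP, ?_⟩
    exact image_prodMap_leftInvOn h.rows.invOn_invFunOn.2 h.cols.invOn_invFunOn.2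
      fun i j hij => ⟨(hP.mem i j hij).1, (hP.mem i j hij).2.1⟩

/-- The transposed board. -/
def swap (B : Board) : Board where
  rows := B.cols
  cols := B.rows
  above := B.left
  left := B.above
  cell i j := B.cell j i
  root := B.root.swap

theorem IsFilling.swap {B : Board} {P : Finset (ℕ × ℕ)} (h : B.IsFilling P) :
    B.swap.IsFilling (P.image Prod.swap) := by
  have hm : ∀ i j, (i, j) ∈ P.image Prod.swap ↔ (j, i) ∈ P := by simp
  refine ⟨?_, ?_, ?_, ?_, ?_⟩
  · intro i j hij
    obtain ⟨h1, h2, h3⟩ := h.mem _ _ ((hm _ _).1 hij)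
    exact ⟨h2, h1, h3⟩
  · exact (hm _ _).2 h.root
  · intro i j hij hne
    simp only [hm] at hij ⊢
    rw [xor_comm]
    exact h.xor _ _ hij fun h0 => hne (by rw [Board.swap, ← h0]; rfl)
  · intro i hi
    simpa only [hm] using h.col i hi
  · intro i hi
    simpa only [hm] using h.row i hi

theorem image_swap_image_swap (P : Finset (ℕ × ℕ)) : (P.image Prod.swap).image Prod.swap = P := by
  rw [Finset.image_image, Prod.swap_swap_eq, Finset.image_id]

theorem ncard_filter_swap (B : Board) (p : Finset (ℕ × ℕ) → Prop) :
    {P ∈ B.swap.fillings | p P}.ncard = {P ∈ B.fillings | p (P.image Prod.swap)}.ncard := by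
  refine Set.BijOn.ncard_eq (f := fun P => P.image Prod.swap) ?_
  refine Set.BijOn.mk ?_ ?_ ?_
  · rintro P ⟨hP, h⟩
    exact ⟨hP.swap, by rwa [image_swap_image_swap]⟩
  · exact fun P _ Q _ h => by simpa [image_swap_image_swap] using congrArg (Finset.image Prod.swap) h
  · rintro P ⟨hP, h⟩
    exact ⟨_, ⟨IsFilling.swap hP, h⟩, image_swap_image_swap P⟩

theorem count_swap (B : Board) : B.swap.count = B.count := by
  simpa [count] using B.ncard_filter_swap fun _ => True

/-- The board without the column `c`. -/
def eraseCol (B : Board) (c : ℕ) : Board := { B with cols := B.cols.erase c }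

/-- The board without the row `r`. -/
def eraseRow (B : Board) (r : ℕ) : Board := { B with rows := B.rows.erase r }

/-- The board without the cell `(r, c)`. -/
def eraseCell (B : Board) (r c : ℕ) : Board :=
  { B with cell := fun i j => B.cell i j ∧ (i, j) ≠ (r, c) }

/-- The row `r` and the column `c` meet in a corner different from the root. -/
structure IsCorner (B : Board) (r c : ℕ) : Prop where
  row_mem : r ∈ B.rows
  col_mem : c ∈ B.cols
  cell : B.cell r c
  above : ∀ i ∈ B.rows, B.cell i c → i ≠ r → B.above i r ∧ ¬ B.above r i
  left : ∀ j ∈ B.cols, B.cell r j → j ≠ c → B.left j c ∧ ¬ B.left c j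
  above_irrefl : ¬ B.above r r
  left_irrefl : ¬ B.left c c
  ne_root : (r, c) ≠ B.root

theorem IsCorner.swap {B : Board} {r c : ℕ} (h : B.IsCorner r c) : B.swap.IsCorner c r where
  row_mem := h.col_mem
  col_mem := h.row_mem
  cell := h.cell
  above := h.left
  left := h.above
  above_irrefl := h.left_irrefl
  left_irrefl := h.above_irrefl
  ne_root := fun h0 => h.ne_root (Prod.swap_injective h0)

theorem fillings_eraseCell (B : Board) (r c : ℕ) :
    (B.eraseCell r c).fillings = {P ∈ B.fillings | (r, c) ∉ P} := by
  ext P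
  constructor
  · intro h
    refine ⟨⟨fun i j hij => ?_, h.root, h.xor, h.row, h.col⟩, fun h0 => ?_⟩
    · obtain ⟨h1, h2, h3⟩ := h.mem _ _ hij
      exact ⟨h1, h2, h3.1⟩
    · exact (h.mem _ _ h0).2.2.2 rfl
  · rintro ⟨h, h0⟩
    refine ⟨fun i j hij => ?_, h.root, h.xor, h.row, h.col⟩
    obtain ⟨h1, h2, h3⟩ := h.mem _ _ hij
    exact ⟨h1, h2, h3, fun h4 => h0 (h4 ▸ hij)⟩

/-- A pointed corner with a point to its left has none above it, so it is the only point of its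
column. Removing it affects no other point, because it lies to the left of nothing, and its row
keeps the left point. -/
theorem IsCorner.isFilling_erase {B : Board} {r c : ℕ} (hB : B.IsCorner r c)
    {P : Finset (ℕ × ℕ)} (h : B.IsFilling P) (hrc : (r, c) ∈ P)
    (hl : ∃ j, B.left j c ∧ (r, j) ∈ P) : (B.eraseCol c).IsFilling (P.erase (r, c)) := by
  have hx := h.xor r c hrc hB.ne_root
  have hna : ¬ ∃ i', B.above i' r ∧ (i', c) ∈ P := by
    rcases hx with hx | hx
    · exact absurd hl hx.2
    · exact hx.2
  have hc : ∀ i, (i, c) ∈ P → i = r := by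
    intro i hi
    by_contra hne
    have hm := h.mem _ _ hi
    exact hna ⟨i, (hB.above i hm.1 hm.2.2 hne).1, hi⟩
  have hcol : ∀ i j, (i, j) ∈ P → (i, j) ≠ (r, c) → j ≠ c := by
    rintro i j hij hne rfl
    exact hne (by rw [hc i hij])
  refine ⟨?_, ?_, ?_, ?_, ?_⟩
  · intro i j hij
    obtain ⟨hne, hij⟩ := Finset.mem_erase.1 hij
    obtain ⟨h1, h2, h3⟩ := h.mem _ _ hij
    exact ⟨h1, Finset.mem_erase.2 ⟨hcol _ _ hij hne, h2⟩, h3⟩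
  · exact Finset.mem_erase.2 ⟨hB.ne_root.symm, h.root⟩
  · intro i j hij hr
    obtain ⟨hne, hij'⟩ := Finset.mem_erase.1 hij
    have hj := hcol _ _ hij' hne
    have h1 : (∃ i', B.above i' i ∧ (i', j) ∈ P.erase (r, c)) ↔
        ∃ i', B.above i' i ∧ (i', j) ∈ P := by
      simp [Finset.mem_erase, hj]
    have h2 : (∃ j', B.left j' j ∧ (i, j') ∈ P.erase (r, c)) ↔
        ∃ j', B.left j' j ∧ (i, j') ∈ P := by
      constructor
      · rintro ⟨j', h1, h2⟩
        exact ⟨j', h1, Finset.mem_of_mem_erase h2⟩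
      · rintro ⟨j', h3, h4⟩
        refine ⟨j', h3, Finset.mem_erase.2 ⟨?_, h4⟩⟩
        rintro h0
        obtain ⟨rfl, rfl⟩ := Prod.mk.inj h0
        have hm := h.mem _ _ hij'
        exact (hB.left j hm.2.1 hm.2.2 hj).2 h3
    have := h.xor i j hij' hr
    rw [← h1, ← h2] at this
    exact this
  · intro i hi
    obtain ⟨j, hj⟩ := h.row i hi
    by_cases h0 : (i, j) = (r, c)
    · obtain ⟨rfl, rfl⟩ := Prod.mk.inj h0
      obtain ⟨j', h1, h2⟩ := hl
      refine ⟨j', Finset.mem_erase.2 ⟨?_, h2⟩⟩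
      rintro h0
      obtain ⟨-, rfl⟩ := Prod.mk.inj h0
      exact hB.left_irrefl h1
    · exact ⟨j, Finset.mem_erase.2 ⟨h0, hj⟩⟩
  · intro j hj
    obtain ⟨hne, hj⟩ := Finset.mem_erase.1 hj
    obtain ⟨i, hi⟩ := h.col j hj
    refine ⟨i, Finset.mem_erase.2 ⟨fun h0 => hne (Prod.mk.inj h0).2, hi⟩⟩

/-- The inverse of the previous deletion. Row `r` already contains a point, necessarily left of `c`,
and the restored column is otherwise empty, so the new point satisfies the exclusive condition. -/
theorem IsCorner.isFilling_insert {B : Board} {r c : ℕ} (hB : B.IsCorner r c)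
    {P : Finset (ℕ × ℕ)} (h : (B.eraseCol c).IsFilling P) :
    B.IsFilling (insert (r, c) P) ∧ (∃ j, B.left j c ∧ (r, j) ∈ insert (r, c) P) ∧
      (r, c) ∉ P := by
  have hcol : ∀ i j, (i, j) ∈ P → j ≠ c := fun i j hij =>
    (Finset.mem_erase.1 (h.mem i j hij).2.1).1
  have hmem : ∀ i j, (i, j) ∈ P → i ∈ B.rows ∧ j ∈ B.cols ∧ B.cell i j := fun i j hij =>
    have hm := h.mem i j hij
    ⟨hm.1, Finset.mem_of_mem_erase hm.2.1, hm.2.2⟩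
  have hl : ∃ j, B.left j c ∧ (r, j) ∈ insert (r, c) P := by
    obtain ⟨j, hj⟩ := h.row r hB.row_mem
    have hm := hmem _ _ hj
    exact ⟨j, (hB.left j hm.2.1 hm.2.2 (hcol _ _ hj)).1, Finset.mem_insert_of_mem hj⟩
  refine ⟨⟨?_, ?_, ?_, ?_, ?_⟩, hl, fun h0 => hcol _ _ h0 rfl⟩
  · intro i j hij
    rcases Finset.mem_insert.1 hij with h0 | h0
    · obtain ⟨rfl, rfl⟩ := Prod.mk.inj h0
      exact ⟨hB.row_mem, hB.col_mem, hB.cell⟩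
    · exact hmem _ _ h0
  · exact Finset.mem_insert_of_mem h.root
  · intro i j hij hr
    rcases Finset.mem_insert.1 hij with h0 | h0
    · obtain ⟨rfl, rfl⟩ := Prod.mk.inj h0
      refine Or.inr ⟨hl, ?_⟩
      rintro ⟨i', h1, h2⟩
      rcases Finset.mem_insert.1 h2 with h0 | h0
      · obtain ⟨rfl, -⟩ := Prod.mk.inj h0
        exact hB.above_irrefl h1
      · exact hcol _ _ h0 rfl
    · have hj := hcol _ _ h0
      have h1 : (∃ i', B.above i' i ∧ (i', j) ∈ insert (r, c) P) ↔
          ∃ i', B.above i' i ∧ (i', j) ∈ P := by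
        simp [Finset.mem_insert, hj]
      have h2 : (∃ j', B.left j' j ∧ (i, j') ∈ insert (r, c) P) ↔
          ∃ j', B.left j' j ∧ (i, j') ∈ P := by
        constructor
        · rintro ⟨j', h4, h2⟩
          rcases Finset.mem_insert.1 h2 with h3 | h3
          · obtain ⟨rfl, rfl⟩ := Prod.mk.inj h3
            have hm := hmem _ _ h0
            exact ((hB.left j hm.2.1 hm.2.2 hj).2 h4).elim
          · exact ⟨j', h4, h3⟩
        · rintro ⟨j', h1, h2⟩
          exact ⟨j', h1, Finset.mem_insert_of_mem h2⟩
      rw [h1, h2]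
      exact h.xor i j h0 hr
  · intro i hi
    obtain ⟨j, hj⟩ := h.row i hi
    exact ⟨j, Finset.mem_insert_of_mem hj⟩
  · intro j hj
    by_cases h0 : j = c
    · exact ⟨r, by simp [h0]⟩
    · obtain ⟨i, hi⟩ := h.col j (Finset.mem_erase.2 ⟨h0, hj⟩)
      exact ⟨i, Finset.mem_insert_of_mem hi⟩

theorem IsCorner.ncard_left {B : Board} {r c : ℕ} (hB : B.IsCorner r c) :
    {P ∈ B.fillings | (r, c) ∈ P ∧ ∃ j, B.left j c ∧ (r, j) ∈ P}.ncard =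
      (B.eraseCol c).count := by
  refine Set.BijOn.ncard_eq (f := fun P => P.erase (r, c)) ?_
  refine Set.BijOn.mk ?_ ?_ ?_
  · rintro P ⟨hP, hrc, hl⟩
    exact hB.isFilling_erase hP hrc hl
  · rintro P ⟨-, hP, -⟩ Q ⟨-, hQ, -⟩ h
    simpa [Finset.insert_erase, hP, hQ] using congrArg (insert (r, c)) h
  · intro P hP
    obtain ⟨h1, h2, h3⟩ := hB.isFilling_insert hP
    exact ⟨insert (r, c) P, ⟨h1, Finset.mem_insert_self _ _, h2⟩, Finset.erase_insert h3⟩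

theorem IsCorner.ncard_above {B : Board} {r c : ℕ} (hB : B.IsCorner r c) :
    {P ∈ B.fillings | (r, c) ∈ P ∧ ∃ i, B.above i r ∧ (i, c) ∈ P}.ncard =
      (B.eraseRow r).count := by
  have h := hB.swap.ncard_left
  rw [ncard_filter_swap, show B.swap.eraseCol r = (B.eraseRow r).swap from rfl, count_swap] at h
  rw [← h]
  congr 1
  ext P
  simp [Board.swap]

/-- The exclusive condition at the corner splits the fillings into three disjoint classes: corner
empty, point above, point to the left. This is the source of DE = ED + E + D: deleting the row
leaves D, deleting the column leaves E. -/
theorem IsCorner.count_eq {B : Board} {r c : ℕ} (hB : B.IsCorner r c) :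
    B.count = (B.eraseCell r c).count + (B.eraseRow r).count + (B.eraseCol c).count := by
  have hfin := B.finite_fillings
  have h0 : ∀ p : Finset (ℕ × ℕ) → Prop, {P ∈ B.fillings | p P}.Finite := fun p =>
    hfin.subset (Set.sep_subset _ _)
  rw [← hB.ncard_left, ← hB.ncard_above, count, count, fillings_eraseCell,
    ← Set.ncard_union_eq _ (h0 _) (h0 _), ← Set.ncard_union_eq _ ((h0 _).union (h0 _)) (h0 _)]
  · congr 1
    ext P
    simp only [Set.mem_union, Set.mem_ofPred_eq]
    constructor
    · intro hP
      by_cases hrc : (r, c) ∈ P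
      · rcases hP.xor r c hrc hB.ne_root with h | h
        · exact Or.inl (Or.inr ⟨hP, hrc, h.1⟩)
        · exact Or.inr ⟨hP, hrc, h.1⟩
      · exact Or.inl (Or.inl ⟨hP, hrc⟩)
    · rintro ((h | h) | h) <;> exact h.1
  · rw [Set.disjoint_left]
    rintro P (⟨-, h'⟩ | ⟨hP, hrc, h1⟩) ⟨-, h2, h3⟩
    · exact h' h2
    · rcases hP.xor r c hrc hB.ne_root with h | h
      · exact h.2 h3
      · exact h.2 h1
  · rw [Set.disjoint_left]
    rintro P ⟨-, h⟩ ⟨-, h', -⟩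
    exact h h'

theorem count_eq_zero {B : Board} (h : ∀ P, ¬ B.IsFilling P) : B.count = 0 := by
  rw [count, Set.ncard_eq_zero B.finite_fillings]
  exact Set.eq_empty_iff_forall_notMem.2 h

end Board

/-! ### Boards of words: the recursion as relations between letters -/

/-- The board of a word: the letters `true` are the columns, the letters `false` the rows, and
a column meets the rows that come later in the word. Later rows lie above earlier ones. -/
def wordBoard (l : List Bool) : Board where
  rows := {x ∈ Finset.range l.length | l[x]? = some false}
  cols := {x ∈ Finset.range l.length | l[x]? = some true}
  above := fun i i' => i' < i
  left := fun j j' => j < j'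
  cell := fun i j => j < i
  root := (l.length - 1, 0)

namespace wordBoard

theorem mem_rows {l : List Bool} {x : ℕ} : x ∈ (wordBoard l).rows ↔ l[x]? = some false := by
  simp only [wordBoard, Finset.mem_filter, Finset.mem_range, and_iff_right_iff_imp]
  intro h
  by_contra h'
  simp [List.getElem?_eq_none (not_lt.1 h')] at h

theorem mem_cols {l : List Bool} {x : ℕ} : x ∈ (wordBoard l).cols ↔ l[x]? = some true := by
  simp only [wordBoard, Finset.mem_filter, Finset.mem_range, and_iff_right_iff_imp]
  intro h
  by_contra h'
  simp [List.getElem?_eq_none (not_lt.1 h')] at h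

theorem getElem?_append_pair (a b : List Bool) (s t : Bool) (x : ℕ) :
    (a ++ s :: t :: b)[x]? = if x < a.length then a[x]? else if x = a.length then some s else
      if x = a.length + 1 then some t else b[x - a.length - 2]? := by
  rw [List.getElem?_append]
  split_ifs with h1 h2 h3
  · rfl
  · simp [h2]
  · simp [h3]
  · obtain ⟨y, rfl⟩ : ∃ y, x = a.length + y + 2 := ⟨x - a.length - 2, by omega⟩
    rw [show a.length + y + 2 - a.length = y + 1 + 1 by omega]
    simp

theorem getElem?_append_single (a b : List Bool) (s : Bool) (x : ℕ) :
    (a ++ s :: b)[x]? = if x < a.length then a[x]? else if x = a.length then some s else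
      b[x - a.length - 1]? := by
  rw [List.getElem?_append]
  split_ifs with h1 h2
  · rfl
  · simp [h2]
  · obtain ⟨y, rfl⟩ : ∃ y, x = a.length + y + 1 := ⟨x - a.length - 1, by omega⟩
    rw [show a.length + y + 1 - a.length = y + 1 by omega]
    simp

/-- The hypothesis excludes only the one-cell board, whose corner is the root. -/
theorem isCorner {a b : List Bool} (h : a ≠ [] ∨ b ≠ []) :
    (wordBoard (a ++ true :: false :: b)).IsCorner (a.length + 1) a.length where
  row_mem := by simp [mem_rows]
  col_mem := by simp [mem_cols]
  cell := Nat.lt_succ_self _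
  above i hi hc hne := by
    simp only [wordBoard] at hc ⊢
    omega
  left j hi hc hne := by
    simp only [wordBoard] at hc ⊢
    omega
  above_irrefl := lt_irrefl _
  left_irrefl := lt_irrefl _
  ne_root := by
    rcases h with h | h
    · have := List.length_pos_iff.2 h
      simp only [wordBoard, ne_eq, Prod.mk.injEq, List.length_append, List.length_cons]
      omega
    · have := List.length_pos_iff.2 h
      simp only [wordBoard, ne_eq, Prod.mk.injEq, List.length_append, List.length_cons]
      omega

/-- Moving an index out of the way of a new index `k`. -/
def skip (k x : ℕ) : ℕ := if x < k then x else x + 1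

theorem skip_lt_skip {k x y : ℕ} : skip k x < skip k y ↔ x < y := by
  unfold skip
  split_ifs <;> omega

theorem skip_injective (k : ℕ) : Function.Injective (skip k) := by
  intro x y h
  unfold skip at h
  split_ifs at h <;> omega

theorem bijOn_skip {k : ℕ} {A B : Finset ℕ} (h1 : ∀ x, x ∈ A ↔ skip k x ∈ B) (h2 : k ∉ B) :
    Set.BijOn (skip k) A B := by
  refine Set.BijOn.mk (fun x hx => (h1 x).1 hx) (skip_injective k).injOn fun x hx => ?_
  have hne : x ≠ k := fun h0 => h2 (h0 ▸ hx)
  by_cases hlt : x < k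
  · have hs : skip k x = x := by simp [skip, hlt]
    exact ⟨x, (h1 x).2 (by rwa [hs]), hs⟩
  · have hs : skip k (x - 1) = x := by
      unfold skip
      split_ifs <;> omega
    exact ⟨x - 1, (h1 _).2 (by rwa [hs]), hs⟩

theorem root_mem {l : List Bool} (h : l.getLast? = some false) :
    (wordBoard l).root.1 ∈ (wordBoard l).rows := by
  rw [mem_rows, ← h, List.getLast?_eq_getElem?]
  rfl

theorem root_mem' {l : List Bool} (h : l.head? = some true) :
    (wordBoard l).root.2 ∈ (wordBoard l).cols := by
  rw [mem_cols, ← h, List.head?_eq_getElem?]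
  rfl

/-- The transposition of `k` and `k + 1`. -/
def flip (k x : ℕ) : ℕ := if x = k then k + 1 else if x = k + 1 then k else x

theorem flip_flip (k x : ℕ) : flip k (flip k x) = x := by
  unfold flip
  split_ifs <;> omega

theorem bijOn_flip {k : ℕ} {A B : Finset ℕ} (h : ∀ x, x ∈ A ↔ flip k x ∈ B) :
    Set.BijOn (flip k) A B := by
  refine Set.BijOn.mk (fun x hx => (h x).1 hx) ?_ fun x hx => ?_
  · exact (Function.LeftInverse.injective (flip_flip k)).injOn
  · exact ⟨flip k x, (h _).2 (by rwa [flip_flip]), flip_flip k x⟩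

theorem getElem?_flip (a b : List Bool) (s t : Bool) (x : ℕ) :
    (a ++ t :: s :: b)[flip a.length x]? = (a ++ s :: t :: b)[x]? := by
  rw [getElem?_append_pair, getElem?_append_pair]
  unfold flip
  split_ifs <;> first | rfl | omega

theorem getElem?_skip (a b : List Bool) (s t : Bool) (x : ℕ) :
    (a ++ s :: t :: b)[skip a.length x]? = (a ++ t :: b)[x]? := by
  rw [getElem?_append_pair, getElem?_append_single]
  unfold skip
  split_ifs <;> first | rfl | omega | (congr 1; omega)

theorem getElem?_skip_succ (a b : List Bool) (s t : Bool) (x : ℕ) :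
    (a ++ s :: t :: b)[skip (a.length + 1) x]? = (a ++ s :: b)[x]? := by
  rw [getElem?_append_pair, getElem?_append_single]
  unfold skip
  split_ifs <;> first | rfl | omega | (congr 1; omega)

/-- Exchanging the adjacent letters D and E destroys exactly the cell in which they meet. The order
among rows and the order among columns survive, since the two exchanged letters are of different
kinds. The conditions on `a` and `b` keep the root in place. -/
theorem count_eraseCell {a b : List Bool} (ha : a.head? = some true)
    (hb : b.getLast? = some false) :
    ((wordBoard (a ++ true :: false :: b)).eraseCell (a.length + 1) a.length).count =
      (wordBoard (a ++ false :: true :: b)).count := by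
  have ha' : 0 < a.length := by cases a <;> simp_all
  have hb' : 0 < b.length := by cases b <;> simp_all
  refine Board.Iso.count_eq (e := flip a.length) (f := flip a.length) ⟨?_, ?_, ?_, ?_, ?_, ?_⟩
    (root_mem ?_) (root_mem' ?_)
  · refine bijOn_flip fun x => ?_
    change x ∈ (wordBoard _).rows ↔ _
    rw [mem_rows, mem_rows, getElem?_flip]
  · refine bijOn_flip fun x => ?_
    change x ∈ (wordBoard _).cols ↔ _
    rw [mem_cols, mem_cols, getElem?_flip]
  · intro i hi i' hi'
    change i ∈ (wordBoard _).rows at hi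
    change i' ∈ (wordBoard _).rows at hi'
    have hi1 : i ≠ a.length := by
      rintro rfl
      simp [mem_rows] at hi
    have hi2 : i' ≠ a.length := by
      rintro rfl
      simp [mem_rows] at hi'
    simp only [Board.eraseCell, wordBoard, flip]
    split_ifs <;> omega
  · intro i hi i' hi'
    change i ∈ (wordBoard _).cols at hi
    change i' ∈ (wordBoard _).cols at hi'
    have hi1 : i ≠ a.length + 1 := by
      rintro rfl
      simp [mem_cols] at hi
    have hi2 : i' ≠ a.length + 1 := by
      rintro rfl
      simp [mem_cols] at hi'
    simp only [Board.eraseCell, wordBoard, flip]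
    split_ifs <;> omega
  · intro i hi i' hi'
    change i ∈ (wordBoard _).rows at hi
    change i' ∈ (wordBoard _).cols at hi'
    have hi1 : i ≠ a.length := by
      rintro rfl
      simp [mem_rows] at hi
    have hi2 : i' ≠ a.length + 1 := by
      rintro rfl
      simp [mem_cols] at hi'
    simp only [Board.eraseCell, wordBoard, flip, ne_eq, Prod.mk.injEq]
    split_ifs <;> omega
  · simp only [Board.eraseCell, wordBoard, flip, Prod.mk.injEq, List.length_append,
      List.length_cons]
    constructor
    · rw [if_neg (by omega), if_neg (by omega)]
    · rw [if_neg (by omega), if_neg (by omega)]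
  · simp [hb, List.getLast?_append, List.getLast?_cons]
  · simp [ha]

theorem count_eraseRow {a b : List Bool} (ha : (a ++ [true]).head? = some true)
    (hb : b.getLast? = some false) :
    ((wordBoard (a ++ true :: false :: b)).eraseRow (a.length + 1)).count =
      (wordBoard (a ++ true :: b)).count := by
  have hb' : 0 < b.length := by cases b <;> simp_all
  refine (Board.Iso.count_eq (e := skip (a.length + 1)) (f := skip (a.length + 1))
    ⟨?_, ?_, ?_, ?_, ?_, ?_⟩ (root_mem ?_) (root_mem' ?_)).symm
  · refine bijOn_skip (fun x => ?_) (Finset.notMem_erase _ _)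
    change _ ↔ _ ∈ Finset.erase (wordBoard _).rows _
    rw [Finset.mem_erase, mem_rows, mem_rows, getElem?_skip_succ]
    refine (and_iff_right ?_).symm
    unfold skip
    split_ifs <;> omega
  · refine bijOn_skip (fun x => ?_) ?_
    · change _ ↔ _ ∈ (wordBoard _).cols
      rw [mem_cols, mem_cols, getElem?_skip_succ]
    · change _ ∉ (wordBoard _).cols
      simp [mem_cols]
  · exact fun i _ i' _ => skip_lt_skip.symm
  · exact fun i _ i' _ => skip_lt_skip.symm
  · exact fun i _ i' _ => skip_lt_skip.symm
  · simp only [Board.eraseRow, wordBoard, skip, Prod.mk.injEq, List.length_append,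
      List.length_cons]
    constructor
    · split_ifs <;> omega
    · split_ifs <;> omega
  · simp [hb, List.getLast?_append, List.getLast?_cons]
  · cases a <;> simp_all

theorem count_eraseCol {a b : List Bool} (ha : a.head? = some true)
    (hb : (false :: b).getLast? = some false) :
    ((wordBoard (a ++ true :: false :: b)).eraseCol a.length).count =
      (wordBoard (a ++ false :: b)).count := by
  have ha' : 0 < a.length := by cases a <;> simp_all
  refine (Board.Iso.count_eq (e := skip a.length) (f := skip a.length)
    ⟨?_, ?_, ?_, ?_, ?_, ?_⟩ (root_mem ?_) (root_mem' ?_)).symm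
  · refine bijOn_skip (fun x => ?_) ?_
    · change _ ↔ _ ∈ (wordBoard _).rows
      rw [mem_rows, mem_rows, getElem?_skip]
    · change _ ∉ (wordBoard _).rows
      simp [mem_rows]
  · refine bijOn_skip (fun x => ?_) (Finset.notMem_erase _ _)
    change _ ↔ _ ∈ Finset.erase (wordBoard _).cols _
    rw [Finset.mem_erase, mem_cols, mem_cols, getElem?_skip]
    refine (and_iff_right ?_).symm
    unfold skip
    split_ifs <;> omega
  · exact fun i _ i' _ => skip_lt_skip.symm
  · exact fun i _ i' _ => skip_lt_skip.symm
  · exact fun i _ i' _ => skip_lt_skip.symm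
  · simp only [Board.eraseCol, wordBoard, skip, Prod.mk.injEq, List.length_append,
      List.length_cons]
    constructor
    · split_ifs <;> omega
    · rw [if_pos ha']
  · rw [List.getLast?_append, hb]; rfl
  · simp [ha]

/-- The row of this corner meets only the first column, so without the corner it could contain no
point. -/
theorem count_eraseCell_of_head (b : List Bool) :
    ((wordBoard (true :: false :: b)).eraseCell 1 0).count = 0 := by
  refine Board.count_eq_zero fun P hP => ?_
  obtain ⟨j, hj⟩ := hP.row 1 (by
    change 1 ∈ (wordBoard _).rows
    simp [mem_rows])
  have := (hP.mem _ _ hj).2.2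
  simp only [Board.eraseCell, wordBoard, Nat.lt_one_iff] at this
  exact this.2 (by rw [this.1])

theorem count_eraseCell_of_last (a : List Bool) :
    ((wordBoard (a ++ [true, false])).eraseCell (a.length + 1) a.length).count = 0 := by
  refine Board.count_eq_zero fun P hP => ?_
  obtain ⟨i, hi⟩ := hP.col a.length (by
    change _ ∈ (wordBoard _).cols
    simp [mem_cols])
  have := hP.mem _ _ hi
  have hr : i ∈ (wordBoard (a ++ [true, false])).rows := this.1
  simp only [wordBoard, Finset.mem_filter, Finset.mem_range, List.length_append,
    List.length_cons, List.length_nil] at hr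
  have h1 := this.2.2
  simp only [Board.eraseCell, wordBoard] at h1
  exact h1.2 (by rw [show i = a.length + 1 by omega])

/-- The number of fillings of the board of the word `true :: w ++ [false]`. -/
noncomputable def innerCount (w : List Bool) : ℕ := (wordBoard (true :: (w ++ [false]))).count

theorem innerCount_append (u v : List Bool) :
    innerCount (u ++ true :: false :: v) = innerCount (u ++ false :: true :: v) +
      innerCount (u ++ true :: v) + innerCount (u ++ false :: v) := by
  have h := (isCorner (a := true :: u) (b := v ++ [false]) (by simp)).count_eq
  rw [count_eraseCell (by simp) (by simp), count_eraseRow (by simp) (by simp),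
    count_eraseCol (by simp) (by simp [List.getLast?_cons])] at h
  simpa [innerCount] using h

/-- The recursion at the corner in the first column: the empty-corner term vanishes, and erasing
that column would remove the root. Only the row deletion survives. -/
theorem innerCount_false_cons (w : List Bool) : innerCount (false :: w) = innerCount w := by
  have h := (isCorner (a := []) (b := w ++ [false]) (by simp)).count_eq
  rw [count_eraseRow (by simp) (by simp)] at h
  have h1 := count_eraseCell_of_head (w ++ [false])
  have h2 : ((wordBoard ([] ++ true :: false :: (w ++ [false]))).eraseCol
      ([] : List Bool).length).count = 0 := by
    refine Board.count_eq_zero fun P hP => ?_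
    simpa [Board.eraseCol, wordBoard] using hP.root_mem.2.1
  rw [h2] at h
  simpa [innerCount, h1] using h

/-- The recursion at the corner in the top row: only the column deletion survives, because erasing
that row would remove the root. -/
theorem innerCount_append_true (w : List Bool) : innerCount (w ++ [true]) = innerCount w := by
  have h := (isCorner (a := true :: w) (b := []) (by simp)).count_eq
  rw [count_eraseCol (by simp) (by simp), count_eraseCell_of_last] at h
  have h2 : ((wordBoard (true :: w ++ true :: false :: [])).eraseRow
      ((true :: w).length + 1)).count = 0 := by
    refine Board.count_eq_zero fun P hP => ?_
    simpa [Board.eraseRow, wordBoard] using hP.root_mem.1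
  rw [h2] at h
  simpa [innerCount] using h

theorem innerCount_nil : innerCount [] = 1 := by
  have h : (wordBoard [true, false]).fillings = {{(1, 0)}} := by
    ext P
    simp only [Set.mem_singleton_iff]
    constructor
    · intro hP
      refine Finset.eq_singleton_iff_unique_mem.2 ⟨hP.root, ?_⟩
      rintro ⟨i, j⟩ hij
      have hm := hP.mem _ _ hij
      rw [mem_rows, mem_cols] at hm
      rcases i with _ | _ | i <;> rcases j with _ | _ | j <;> simp_all
    · rintro rfl
      refine ⟨?_, ?_, ?_, ?_, ?_⟩
      · intro i j hij
        simp only [Finset.mem_singleton, Prod.mk.injEq] at hij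
        obtain ⟨rfl, rfl⟩ := hij
        rw [mem_rows, mem_cols]
        simp [wordBoard]
      · simp [wordBoard]
      · intro i j hij hne
        exact absurd (Finset.mem_singleton.1 hij) hne
      · intro i hi
        rw [mem_rows] at hi
        rcases i with _ | _ | i <;> simp_all
      · intro i hi
        rw [mem_cols] at hi
        rcases i with _ | _ | i <;> simp_all
  simp [innerCount, Board.count, h]

end wordBoard

/-! ### Sums over all words of a given length -/

/-- The words of length `n` in two letters. -/
def words : ℕ → Finset (List Bool)
  | 0 => {[]}
  | n + 1 => (words n).map ⟨List.cons true, List.cons_injective⟩ ∪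
      (words n).map ⟨List.cons false, List.cons_injective⟩

theorem mem_words {n : ℕ} {l : List Bool} : l ∈ words n ↔ l.length = n := by
  induction n generalizing l with
  | zero => simp [words]
  | succ n ih =>
    rcases l with _ | ⟨b, l⟩
    · simp [words]
    · cases b <;> simp [words, ih]

theorem sum_words_succ {M : Type*} [AddCommMonoid M] (n : ℕ) (F : List Bool → M) :
    ∑ l ∈ words (n + 1), F l =
      ∑ l ∈ words n, F (true :: l) + ∑ l ∈ words n, F (false :: l) := by
  rw [words, Finset.sum_union, Finset.sum_map, Finset.sum_map]
  · rfl
  · rw [Finset.disjoint_left]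
    intro l h1 h2
    simp only [Finset.mem_map, Function.Embedding.coeFn_mk] at h1 h2
    obtain ⟨a, -, rfl⟩ := h1
    obtain ⟨b, -, h⟩ := h2
    simp at h

theorem sum_words_succ' {M : Type*} [AddCommMonoid M] (n : ℕ) (F : List Bool → M) :
    ∑ l ∈ words (n + 1), F l =
      ∑ l ∈ words n, F (l ++ [true]) + ∑ l ∈ words n, F (l ++ [false]) := by
  induction n generalizing F with
  | zero => simp [words]
  | succ n ih =>
    rw [sum_words_succ, ih, ih, sum_words_succ n (fun l => F (l ++ [true])),
      sum_words_succ n (fun l => F (l ++ [false]))]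
    simp only [List.cons_append]
    abel

/-! ### Commutation with powers of D + E -/

section Ring

variable {A : Type*} [Ring A] {D E : A}

/-- The relation says that the commutator of D with S = D + E is S itself, so D moves past each
factor S at the cost of adding 1. -/
theorem mul_add_pow_of_relation (h : D * E = E * D + (D + E)) (k : ℕ) :
    D * (D + E) ^ k = (D + E) ^ k * (D + k) := by
  have h1 : D * (D + E) = (D + E) * (D + 1) := by
    rw [mul_add, h]
    noncomm_ring
  induction k with
  | zero => simp
  | succ k ih =>
    rw [pow_succ, ← mul_assoc, ih, mul_assoc, mul_assoc]
    congr 1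
    rw [add_mul, h1, Nat.cast_succ, Nat.cast_comm]
    noncomm_ring

theorem mul_add_pow_of_relation' (h : D * E = E * D + (D + E)) (k : ℕ) :
    E * (D + E) ^ k = (D + E) ^ k * (E - k) := by
  have h1 := mul_add_pow_of_relation h k
  have h2 : (D + E) * (D + E) ^ k = (D + E) ^ k * (D + E) := (Commute.refl (D + E)).pow_right k
  have h3 : E * (D + E) ^ k = (D + E) * (D + E) ^ k - D * (D + E) ^ k := by noncomm_ring
  rw [h3, h1, h2]
  noncomm_ring

end Ring

/-! ### The matrix ansatz realised by translations of functions on words -/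

/-- Functions on words invariant under deletion of an initial `false` that satisfy
`h (uDEv) = h (uEDv) + h (uDv) + h (uEv)`, where `D` is `true` and `E` is `false`. -/
def exclusionModule : Submodule ℚ (List Bool → ℚ) where
  carrier := {h | (∀ u v, h (u ++ true :: false :: v) =
      h (u ++ false :: true :: v) + (h (u ++ true :: v) + h (u ++ false :: v))) ∧
    ∀ v, h (false :: v) = h v}
  zero_mem' := by simp
  add_mem' := by
    rintro a b ⟨h1, h2⟩ ⟨h3, h4⟩
    refine ⟨fun u v => ?_, fun v => ?_⟩
    · simp only [Pi.add_apply, h1, h3]; ring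
    · simp only [Pi.add_apply, h2, h4]
  smul_mem' := by
    rintro c b ⟨h3, h4⟩
    refine ⟨fun u v => ?_, fun v => ?_⟩
    · simp only [Pi.smul_apply, h3, smul_eq_mul]; ring
    · simp only [Pi.smul_apply, h4]

namespace exclusionModule

/-- Translation by a letter on the right. -/
def shift (b : Bool) : Module.End ℚ exclusionModule where
  toFun h := ⟨fun w => h.1 (w ++ [b]), fun u v => by
    simpa using h.2.1 u (v ++ [b]), fun v => by simpa using h.2.2 (v ++ [b])⟩
  map_add' _ _ := rfl
  map_smul' _ _ := rfl

theorem shift_apply (b : Bool) (h : exclusionModule) (w : List Bool) :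
    (shift b h).1 w = h.1 (w ++ [b]) := rfl

/-- Translations append letters on the right, so a product of operators reads as the word in the
same order. Evaluation at the empty word plays the role of ⟨W|, and an element fixed by `shift true`
that of |V⟩. -/
theorem shift_relation : shift true * shift false =
    shift false * shift true + (shift true + shift false) := by
  ext h w
  simpa [shift_apply] using h.2.1 w []

theorem shift_false_nil (h : exclusionModule) : (shift false h).1 [] = h.1 [] := by
  simpa [shift_apply] using h.2.2 []

/-- The sum of the two translations. -/
def total : Module.End ℚ exclusionModule := shift true + shift false

theorem total_pow_apply (n : ℕ) (h : exclusionModule) (u : List Bool) :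
    ((total ^ n) h).1 u = ∑ w ∈ words n, h.1 (u ++ w) := by
  induction n generalizing u with
  | zero => simp [words]
  | succ n ih =>
    rw [pow_succ', sum_words_succ]
    change ((total ^ n) h).1 (u ++ [true]) + ((total ^ n) h).1 (u ++ [false]) = _
    simp [ih]

/-- Evaluate E S^k = S^k (E - k) at the empty word, where the E on the left is absorbed. -/
theorem shift_false_total_pow (f : exclusionModule) (k : ℕ) :
    ((total ^ k) (shift false f)).1 [] = (k + 1) * ((total ^ k) f).1 [] := by
  have h1 : shift false * total ^ k = total ^ k * (shift false - k) :=
    mul_add_pow_of_relation' (D := shift true) shift_relation k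
  have h2 := congrArg (fun g : Module.End ℚ exclusionModule => (g f).1 []) h1
  simp only [Module.End.mul_apply, shift_false_nil] at h2
  have h3 : ((total ^ k) ((shift false - (k : Module.End ℚ exclusionModule)) f)).1 [] =
      ((total ^ k) (shift false f)).1 [] - k * ((total ^ k) f).1 [] := by
    have : (k : Module.End ℚ exclusionModule) f = (k : ℚ) • f := by
      rw [Module.End.natCast_apply, Nat.cast_smul_eq_nsmul]
    rw [LinearMap.sub_apply, this, map_sub, map_smul]
    rfl
  rw [h3] at h2
  linarith

theorem total_pow_succ_nil {f : exclusionModule} (hf : shift true f = f) (k : ℕ) :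
    ((total ^ (k + 1)) f).1 [] = (k + 2) * ((total ^ k) f).1 [] := by
  have h := shift_false_total_pow f k
  have h1 : (total ^ (k + 1)) f = (total ^ k) f + (total ^ k) (shift false f) := by
    rw [pow_succ, Module.End.mul_apply, ← map_add]
    congr 1
    change shift true f + shift false f = _
    rw [hf]
  rw [h1]
  change ((total ^ k) f).1 [] + ((total ^ k) (shift false f)).1 [] = _
  rw [h]
  ring

theorem total_pow_nil {f : exclusionModule} (hf : shift true f = f) (k : ℕ) :
    ((total ^ k) f).1 [] = (k + 1)! * f.1 [] := by
  induction k with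
  | zero => simp
  | succ k ih =>
    rw [total_pow_succ_nil hf, ih, Nat.factorial_succ (k + 1)]
    push_cast
    ring

/-- Moving S^j to the left turns ED into (E - j)(D + j). On a vector fixed by D the second factor is
the scalar j + 1, and S^(i+j) E then contributes the factor i + j + 1. The last bracket equals
(j+1)(i+1). -/
theorem total_pow_shift_shift {f : exclusionModule} (hf : shift true f = f) (i j : ℕ) :
    ((total ^ i * (shift false * shift true) * total ^ j) f).1 [] =
      (i + j + 1)! * f.1 [] * ((i + j + 1 : ℚ) + j * (i + j) - j ^ 2) := by
  have hD : shift true * total ^ j = total ^ j * (shift true + j) :=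
    mul_add_pow_of_relation (E := shift false) shift_relation j
  have hE : shift false * total ^ j = total ^ j * (shift false - j) :=
    mul_add_pow_of_relation' (D := shift true) shift_relation j
  have h1 : total ^ i * (shift false * shift true) * total ^ j =
      total ^ (i + j) * ((shift false - j) * (shift true + j)) := by
    rw [mul_assoc, mul_assoc, hD, ← mul_assoc (shift false), hE, pow_add]
    noncomm_ring
  have h2 : ((shift false - (j : Module.End ℚ exclusionModule)) * (shift true + j)) f =
      (j + 1 : ℚ) • shift false f - (j * (j + 1) : ℚ) • f := by
    have : ∀ g : exclusionModule, (j : Module.End ℚ exclusionModule) g = (j : ℚ) • g := fun g => by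
      rw [Module.End.natCast_apply, Nat.cast_smul_eq_nsmul]
    rw [Module.End.mul_apply, LinearMap.add_apply, hf, LinearMap.sub_apply, this, this, map_add,
      map_smul]
    module
  rw [h1, Module.End.mul_apply, h2, map_sub, map_smul, map_smul]
  change (j + 1 : ℚ) * ((total ^ (i + j)) (shift false f)).1 [] -
    (j * (j + 1) : ℚ) * ((total ^ (i + j)) f).1 [] = _
  rw [shift_false_total_pow f, total_pow_nil hf]
  push_cast
  ring

theorem total_pow_shift_shift_apply (f : exclusionModule) (i j : ℕ) :
    ((total ^ i * (shift false * shift true) * total ^ j) f).1 [] =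
      ∑ u ∈ words i, ∑ v ∈ words j, f.1 (u ++ false :: true :: v) := by
  rw [Module.End.mul_apply, Module.End.mul_apply, total_pow_apply]
  refine Finset.sum_congr rfl fun u _ => ?_
  rw [Module.End.mul_apply, shift_apply, shift_apply, total_pow_apply]
  simp

theorem sum_antidiagonal (m : ℕ) :
    ∑ p ∈ Finset.HasAntidiagonal.antidiagonal m, ((p.1 + p.2 + 1 : ℚ) + p.2 * (p.1 + p.2) - p.2 ^ 2) =
      (m + 1) * (m + 2) * (m + 3) / 6 := by
  have h : ∀ p ∈ Finset.HasAntidiagonal.antidiagonal m, ((p.1 + p.2 + 1 : ℚ) + p.2 * (p.1 + p.2) - p.2 ^ 2) =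
      (m + 1) + (p.2 : ℚ) * m - p.2 ^ 2 := by
    intro p hp
    rw [← Finset.HasAntidiagonal.mem_antidiagonal.1 hp]
    push_cast
    ring
  rw [Finset.sum_congr rfl h, Finset.Nat.sum_antidiagonal_eq_sum_range_succ_mk]
  -- The parameter in the summand is decoupled from the length of the range so that induction on the
  -- length applies.
  have h2 : ∀ x : ℚ, ∀ m : ℕ, ∑ k ∈ Finset.range (m + 1), ((x + 1) + (k : ℚ) * x - k ^ 2) =
      (m + 1) * (x + 1) + x * (m * (m + 1) / 2) - m * (m + 1) * (2 * m + 1) / 6 := by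
    intro x m
    induction m with
    | zero => simp
    | succ m ih =>
      rw [Finset.sum_range_succ, ih]
      push_cast
      ring
  have h3 := Finset.sum_range_reflect (fun k : ℕ => ((m + 1 : ℚ) + (k : ℚ) * m - k ^ 2)) (m + 1)
  rw [h2] at h3
  simp only [Nat.add_sub_cancel] at h3
  rw [Nat.succ_eq_add_one, h3]
  ring

/-- The sum of `f (u ++ false :: true :: v)` over all words `u`, `v` of total length `m`. -/
theorem sum_words_false_true {f : exclusionModule} (hf : shift true f = f) (m : ℕ) :
    ∑ p ∈ Finset.HasAntidiagonal.antidiagonal m, ∑ u ∈ words p.1, ∑ v ∈ words p.2,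
      f.1 (u ++ false :: true :: v) = (m + 3)! * f.1 [] * ((m + 1) / 6) := by
  have h : ∀ p ∈ Finset.HasAntidiagonal.antidiagonal m, ∑ u ∈ words p.1, ∑ v ∈ words p.2,
      f.1 (u ++ false :: true :: v) = (m + 1)! * f.1 [] *
        ((p.1 + p.2 + 1 : ℚ) + p.2 * (p.1 + p.2) - p.2 ^ 2) := by
    intro p hp
    rw [← total_pow_shift_shift_apply, total_pow_shift_shift hf, Finset.HasAntidiagonal.mem_antidiagonal.1 hp]
  rw [Finset.sum_congr rfl h, ← Finset.mul_sum, sum_antidiagonal, Nat.factorial_succ (m + 2),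
    Nat.factorial_succ (m + 1)]
  push_cast
  ring

end exclusionModule

/-! ### Young diagrams and their border words -/

theorem Board.Iso.eraseCell {B B' : Board} {e f : ℕ → ℕ} (h : B.Iso B' e f) {r c : ℕ}
    (hr : r ∈ B.rows) (hc : c ∈ B.cols) :
    (B.eraseCell r c).Iso (B'.eraseCell (e r) (f c)) e f where
  rows := h.rows
  cols := h.cols
  above := h.above
  left := h.left
  cell i hi j hj := by
    change B.cell i j ∧ _ ↔ B'.cell (e i) (f j) ∧ _
    rw [h.cell i hi j hj, ne_eq, ne_eq, Prod.mk.injEq, Prod.mk.injEq, h.rows.injOn.eq_iff hi hr,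
      h.cols.injOn.eq_iff hj hc]
  root := h.root

theorem eq_of_image_range_eq {f g : ℕ → ℕ} {n : ℕ} (hf : StrictMonoOn f (Set.Iio n))
    (hg : StrictMonoOn g (Set.Iio n)) (h : (Finset.range n).image f = (Finset.range n).image g)
    {j : ℕ} (hj : j < n) : f j = g j := by
  have rank : ∀ {f : ℕ → ℕ}, StrictMonoOn f (Set.Iio n) → ∀ {j}, j < n →
      ((((Finset.range n).image f).filter (· < f j)).card = j) := by
    intro f hf j hj
    have : ((Finset.range n).image f).filter (· < f j) = (Finset.range j).image f := by
      ext x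
      simp only [Finset.mem_filter, Finset.mem_image, Finset.mem_range]
      constructor
      · rintro ⟨⟨a, ha, rfl⟩, hlt⟩
        exact ⟨a, (hf.lt_iff_lt ha hj).1 hlt, rfl⟩
      · rintro ⟨a, ha, rfl⟩
        exact ⟨⟨a, ha.trans hj, rfl⟩, hf (ha.trans hj) hj ha⟩
    rw [this, Finset.card_image_of_injOn, Finset.card_range]
    exact hf.injOn.mono fun x hx => (Finset.mem_range.1 hx).trans hj
  have h1 : f j ∈ (Finset.range n).image g := h ▸ Finset.mem_image_of_mem f (Finset.mem_range.2 hj)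
  obtain ⟨i, hi, hij⟩ := Finset.mem_image.1 h1
  have h2 := rank hg (Finset.mem_range.1 hi)
  rw [hij, ← h, rank hf hj] at h2
  rw [← hij, h2]

namespace YoungDiagram

/-- The position in the border path, read from bottom left, of the step below column `j`. -/
def borderCol (μ : YoungDiagram) (j : ℕ) : ℕ := j + (μ.colLen 0 - μ.colLen j)

/-- The position in the border path, read from bottom left, of the step right of row `i`. -/
def borderRow (μ : YoungDiagram) (i : ℕ) : ℕ := μ.rowLen i + (μ.colLen 0 - 1 - i)

/-- The border path of a Young diagram from bottom left to top right. -/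
def borderWord (μ : YoungDiagram) : List Bool :=
  (List.range (μ.colLen 0 + μ.rowLen 0)).map fun x => decide (∃ j < μ.rowLen 0, μ.borderCol j = x)

variable {μ : YoungDiagram}

theorem colLen_pos_of_lt {j : ℕ} (h : j < μ.rowLen 0) : 0 < μ.colLen j := by
  rwa [← mem_iff_lt_colLen, mem_iff_lt_rowLen]

theorem borderCol_strictMono (μ : YoungDiagram) : StrictMono μ.borderCol := by
  intro j j' h
  have h1 := μ.colLen_anti j j' h.le
  unfold borderCol
  omega

theorem borderRow_lt_borderRow {i i' : ℕ} (h : i < i') (h' : i' < μ.colLen 0) :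
    μ.borderRow i' < μ.borderRow i := by
  have h1 := μ.rowLen_anti i i' h.le
  unfold borderRow
  omega

theorem borderRow_lt_iff {i i' : ℕ} (h : i < μ.colLen 0) (h' : i' < μ.colLen 0) :
    μ.borderRow i' < μ.borderRow i ↔ i < i' := by
  refine ⟨fun h0 => ?_, fun h0 => borderRow_lt_borderRow h0 h'⟩
  by_contra h1
  rcases (not_lt.1 h1).eq_or_lt with h2 | h2
  · exact h0.ne (by rw [h2])
  · exact lt_asymm h0 (borderRow_lt_borderRow h2 h)

theorem borderRow_injOn (μ : YoungDiagram) : Set.InjOn μ.borderRow (Set.Iio (μ.colLen 0)) := by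
  intro i hi i' hi' h
  by_contra hne
  rcases lt_or_gt_of_ne hne with h1 | h1
  · exact (borderRow_lt_borderRow h1 hi').ne h.symm
  · exact (borderRow_lt_borderRow h1 hi).ne h

/-- Both `j < μ.rowLen i` and `i < μ.colLen j` express membership. When they hold, they bound
`borderCol j` and `borderRow i` in one direction; when they fail, in the other. -/
theorem mem_iff_border {i j : ℕ} (hi : i < μ.colLen 0) :
    (i, j) ∈ μ ↔ μ.borderCol j < μ.borderRow i := by
  have h1 : (i, j) ∈ μ ↔ j < μ.rowLen i := mem_iff_lt_rowLen
  have h2 : (i, j) ∈ μ ↔ i < μ.colLen j := mem_iff_lt_colLen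
  have h3 := μ.colLen_anti 0 j (Nat.zero_le _)
  unfold borderCol borderRow
  by_cases h : (i, j) ∈ μ
  · have := h1.1 h
    have := h2.1 h
    refine iff_of_true h (by omega)
  · have := mt h1.2 h
    have := mt h2.2 h
    refine iff_of_false h (by omega)

theorem borderCol_ne_borderRow {i j : ℕ} (hi : i < μ.colLen 0) :
    μ.borderCol j ≠ μ.borderRow i := by
  have h1 : (i, j) ∈ μ ↔ j < μ.rowLen i := mem_iff_lt_rowLen
  have h2 : (i, j) ∈ μ ↔ i < μ.colLen j := mem_iff_lt_colLen
  have h3 := μ.colLen_anti 0 j (Nat.zero_le _)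
  unfold borderCol borderRow
  by_cases h : (i, j) ∈ μ
  · have := h1.1 h
    have := h2.1 h
    omega
  · have := mt h1.2 h
    have := mt h2.2 h
    omega

theorem borderCol_lt {j : ℕ} (hj : j < μ.rowLen 0) :
    μ.borderCol j < μ.colLen 0 + μ.rowLen 0 := by
  have := colLen_pos_of_lt hj
  unfold borderCol
  omega

theorem borderRow_lt {i : ℕ} (hi : i < μ.colLen 0) :
    μ.borderRow i < μ.colLen 0 + μ.rowLen 0 := by
  have := μ.rowLen_anti 0 i (Nat.zero_le _)
  unfold borderRow
  omega

theorem length_borderWord (μ : YoungDiagram) :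
    μ.borderWord.length = μ.colLen 0 + μ.rowLen 0 := by
  simp [borderWord]

theorem borderWord_eq_true {x : ℕ} :
    μ.borderWord[x]? = some true ↔ ∃ j < μ.rowLen 0, μ.borderCol j = x := by
  constructor
  · intro h
    simp only [borderWord, List.getElem?_map, Option.map_eq_some_iff, decide_eq_true_eq] at h
    obtain ⟨a, ha, hb⟩ := h
    obtain ⟨_, rfl⟩ := List.getElem?_eq_some_iff.1 ha
    simpa using hb
  · rintro ⟨j, hj, rfl⟩
    have := borderCol_lt hj
    simp only [borderWord, List.getElem?_map, List.getElem?_range this, Option.map_some,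
      Option.some.injEq, decide_eq_true_eq]
    exact ⟨j, hj, rfl⟩

/-- Row and column positions are disjoint subsets of the positions of the path, and their numbers
add up to its length, so they are complementary. -/
theorem borderWord_eq_false {x : ℕ} :
    μ.borderWord[x]? = some false ↔ ∃ i < μ.colLen 0, μ.borderRow i = x := by
  set N := μ.colLen 0 + μ.rowLen 0
  set A := (Finset.range (μ.rowLen 0)).image μ.borderCol with hA
  set B := (Finset.range (μ.colLen 0)).image μ.borderRow with hB
  have hAc : A.card = μ.rowLen 0 := by
    rw [hA, Finset.card_image_of_injective _ μ.borderCol_strictMono.injective, Finset.card_range]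
  have hBc : B.card = μ.colLen 0 := by
    rw [hB, Finset.card_image_of_injOn, Finset.card_range]
    exact μ.borderRow_injOn.mono fun x hx => Finset.mem_range.1 hx
  have hAN : A ⊆ Finset.range N := by
    intro x hx
    obtain ⟨j, hj, rfl⟩ := Finset.mem_image.1 hx
    exact Finset.mem_range.2 (borderCol_lt (Finset.mem_range.1 hj))
  have hBA : B = Finset.range N \ A := by
    refine Finset.eq_of_subset_of_card_le ?_ ?_
    · intro x hx
      obtain ⟨i, hi, rfl⟩ := Finset.mem_image.1 hx
      refine Finset.mem_sdiff.2 ⟨Finset.mem_range.2 (borderRow_lt (Finset.mem_range.1 hi)), ?_⟩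
      intro hx'
      obtain ⟨j, hj, h⟩ := Finset.mem_image.1 hx'
      exact borderCol_ne_borderRow (Finset.mem_range.1 hi) h
    · rw [Finset.card_sdiff_of_subset hAN, hAc, hBc, Finset.card_range]
      omega
  have h1 : x ∈ A ↔ μ.borderWord[x]? = some true := by
    rw [borderWord_eq_true, hA]
    simp
  have h2 : x ∈ B ↔ ∃ i < μ.colLen 0, μ.borderRow i = x := by
    rw [hB]
    simp
  rw [← h2, hBA, Finset.mem_sdiff, h1, Finset.mem_range]
  change _ ↔ x < μ.colLen 0 + μ.rowLen 0 ∧ _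
  rw [← length_borderWord]
  by_cases hx : x < μ.borderWord.length
  · rw [List.getElem?_eq_getElem hx]
    cases μ.borderWord[x] <;> simp [hx]
  · simp [hx]

/-- The board of a Young diagram. -/
def board (μ : YoungDiagram) : Board where
  rows := Finset.range (μ.colLen 0)
  cols := Finset.range (μ.rowLen 0)
  above := (· < ·)
  left := (· < ·)
  cell i j := (i, j) ∈ μ
  root := (0, 0)

theorem board_iso (h : (0, 0) ∈ μ) :
    μ.board.Iso (wordBoard μ.borderWord) μ.borderRow μ.borderCol where
  rows := by
    refine ⟨fun i hi => ?_, ?_, fun x hx => ?_⟩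
    · exact wordBoard.mem_rows.2 (borderWord_eq_false.2 ⟨i, Finset.mem_range.1 hi, rfl⟩)
    · exact μ.borderRow_injOn.mono fun x hx => Finset.mem_range.1 hx
    · obtain ⟨i, hi, rfl⟩ := borderWord_eq_false.1 (wordBoard.mem_rows.1 hx)
      exact ⟨i, Finset.mem_range.2 hi, rfl⟩
  cols := by
    refine ⟨fun i hi => ?_, μ.borderCol_strictMono.injective.injOn, fun x hx => ?_⟩
    · exact wordBoard.mem_cols.2 (borderWord_eq_true.2 ⟨i, Finset.mem_range.1 hi, rfl⟩)
    · obtain ⟨i, hi, rfl⟩ := borderWord_eq_true.1 (wordBoard.mem_cols.1 hx)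
      exact ⟨i, Finset.mem_range.2 hi, rfl⟩
  above i hi i' hi' := (borderRow_lt_iff (Finset.mem_range.1 hi) (Finset.mem_range.1 hi')).symm
  left j _ j' _ := μ.borderCol_strictMono.lt_iff_lt.symm
  cell i hi j _ := mem_iff_border (Finset.mem_range.1 hi)
  root := by
    have := mem_iff_lt_colLen.1 h
    simp only [wordBoard, length_borderWord, board, borderRow, borderCol, Prod.mk.injEq]
    omega

theorem head?_borderWord (h : (0, 0) ∈ μ) : μ.borderWord.head? = some true := by
  rw [List.head?_eq_getElem?, borderWord_eq_true]
  exact ⟨0, mem_iff_lt_rowLen.1 h, by simp [borderCol]⟩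

theorem getLast?_borderWord (h : (0, 0) ∈ μ) : μ.borderWord.getLast? = some false := by
  rw [List.getLast?_eq_getElem?, borderWord_eq_false]
  have := mem_iff_lt_colLen.1 h
  refine ⟨0, this, ?_⟩
  rw [borderRow, length_borderWord]
  omega

/-- The set of column positions determines the increasing function `borderCol`, and this together
with the number of rows determines the column lengths. -/
theorem borderWord_injective {μ ν : YoungDiagram} (h : μ.borderWord = ν.borderWord) : μ = ν := by
  have hl := congrArg List.length h
  rw [length_borderWord, length_borderWord] at hl
  have him : (Finset.range (μ.rowLen 0)).image μ.borderCol =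
      (Finset.range (ν.rowLen 0)).image ν.borderCol := by
    ext x
    have := borderWord_eq_true (μ := μ) (x := x)
    rw [h, borderWord_eq_true] at this
    simpa using this.symm
  have hC : μ.rowLen 0 = ν.rowLen 0 := by
    have := congrArg Finset.card him
    rwa [Finset.card_image_of_injective _ μ.borderCol_strictMono.injective,
      Finset.card_image_of_injective _ ν.borderCol_strictMono.injective, Finset.card_range,
      Finset.card_range] at this
  have hR : μ.colLen 0 = ν.colLen 0 := by omega
  have hcol : ∀ j, μ.colLen j = ν.colLen j := by
    intro j
    by_cases hj : j < μ.rowLen 0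
    · rw [← hC] at him
      have h1 := eq_of_image_range_eq (μ.borderCol_strictMono.strictMonoOn _)
        (ν.borderCol_strictMono.strictMonoOn _) him hj
      have h2 := μ.colLen_anti 0 j (Nat.zero_le _)
      have h3 := ν.colLen_anti 0 j (Nat.zero_le _)
      unfold borderCol at h1
      omega
    · have hz : ∀ ξ : YoungDiagram, ¬ j < ξ.rowLen 0 → ξ.colLen j = 0 := by
        intro ξ hξ
        by_contra h0
        exact hξ (mem_iff_lt_rowLen.1 (mem_iff_lt_colLen.2 (Nat.pos_of_ne_zero h0)))
      rw [hz μ hj, hz ν (hC ▸ hj)]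
  ext ⟨i, j⟩
  rw [mem_cells, mem_cells, mem_iff_lt_colLen, mem_iff_lt_colLen, hcol]

theorem exists_borderWord_eq {l : List Bool} (hh : l.head? = some true)
    (hl : l.getLast? = some false) : ∃ μ : YoungDiagram, (0, 0) ∈ μ ∧ μ.borderWord = l := by
  set H := (wordBoard l).cols with hH
  set C := H.card with hC
  set m := l.length with hm
  have hHm : ∀ x ∈ H, x + 1 < m := by
    intro x hx
    have h1 := wordBoard.mem_cols.1 hx
    have h2 := (List.getElem?_eq_some_iff.1 h1).1
    rw [List.getLast?_eq_getElem?] at hl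
    by_contra h3
    rw [show l.length - 1 = x by omega, h1] at hl
    simp at hl
  have h0H : 0 ∈ H := by
    rw [hH, wordBoard.mem_cols, ← hh, List.head?_eq_getElem?]
  -- `q` lists the positions of the columns in increasing order; its value 0 beyond `C` plays no
  -- role.
  obtain ⟨q, hq, himg⟩ : ∃ q : ℕ → ℕ, StrictMonoOn q (Set.Iio C) ∧
      ∀ x, x ∈ H ↔ ∃ j < C, q j = x := by
    refine ⟨fun j => if h : j < C then H.orderEmbOfFin rfl ⟨j, h⟩ else 0, ?_, fun x => ?_⟩
    · intro i hi j hj hij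
      simp only [Set.mem_Iio] at hi hj
      simpa [hi, hj] using hij
    · have := Set.ext_iff.1 (H.range_orderEmbOfFin rfl) x
      rw [Finset.mem_coe] at this
      rw [← this]
      constructor
      · rintro ⟨⟨j, hj⟩, h⟩
        exact ⟨j, hj, (dif_pos hj).trans h⟩
      · rintro ⟨j, hj, h⟩
        exact ⟨_, (dif_pos hj).symm.trans h⟩
  have hstep : ∀ j, j < C → ∀ j' ≤ j, q j' + (j - j') ≤ q j := by
    intro j
    induction j with
    | zero => intro _ j' hj'; simp [Nat.le_zero.1 hj']
    | succ j ih =>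
      intro hj j' hj'
      rcases hj'.eq_or_lt with rfl | h1
      · simp
      · have h2 := ih (by omega) j' (by omega)
        have h3 := hq (show j ∈ Set.Iio C from by simp; omega) hj (Nat.lt_succ_self j)
        omega
  have hCpos : 0 < C := Finset.card_pos.2 ⟨0, h0H⟩
  have hCm : C ≤ m := by
    have : H ⊆ Finset.range m := fun x hx => Finset.mem_range.2 (by have := hHm x hx; omega)
    simpa using Finset.card_le_card this
  obtain ⟨R, hR⟩ : ∃ R, m = R + C := ⟨m - C, by omega⟩
  have hge : ∀ j < C, j ≤ q j := fun j hj => by have := hstep j hj 0 (Nat.zero_le _); omega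
  -- This is where the final letter `false` matters: every column gets positive length.
  have hlt : ∀ j < C, q j < j + R := by
    intro j hj
    have h1 := hstep (C - 1) (by omega) j (by omega)
    have h2 := hHm (q (C - 1)) ((himg _).2 ⟨C - 1, by omega, rfl⟩)
    omega
  have hq0 : q 0 = 0 := by
    obtain ⟨j, hj, h⟩ := (himg 0).1 h0H
    have := hge j hj
    rwa [show j = 0 by omega] at h
  -- Before column `j` the path has passed `q j - j` rows, so the column must have length `R - (q j
  -- - j)`; the condition is written additively to avoid truncated subtraction.
  let μ : YoungDiagram :=
    { cells := {c ∈ Finset.range R ×ˢ Finset.range C | c.1 + q c.2 < c.2 + R}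
      isLowerSet := by
        rintro ⟨i, j⟩ ⟨i', j'⟩ ⟨h1, h2⟩ h
        simp only [Finset.coe_filter, Finset.mem_product, Finset.mem_range,
          Set.mem_ofPred_eq] at h h1 h2 ⊢
        have := hstep j h.1.2 j' h2
        omega }
  have hμ : ∀ i j, (i, j) ∈ μ ↔ (i < R ∧ j < C) ∧ i + q j < j + R := by
    intro i j
    rw [← mem_cells]
    simp [μ]
  have hcol : ∀ j < C, μ.colLen j = j + R - q j := by
    intro j hj
    have h1 : ∀ i, i < μ.colLen j ↔ i < j + R - q j := by
      intro i
      rw [← mem_iff_lt_colLen, hμ]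
      have := hge j hj
      omega
    have h2 := h1 (μ.colLen j)
    have h3 := h1 (j + R - q j)
    omega
  have hR0 : μ.colLen 0 = R := by rw [hcol 0 hCpos, hq0]; omega
  have hC0 : μ.rowLen 0 = C := by
    have h1 : ∀ j, j < μ.rowLen 0 ↔ j < C := by
      intro j
      rw [← mem_iff_lt_rowLen, hμ]
      have := hlt j
      have := hlt 0 hCpos
      constructor
      · exact fun h => h.1.2
      · intro h
        have := hlt j h
        omega
    have h2 := h1 (μ.rowLen 0)
    have h3 := h1 C
    omega
  have hbc : ∀ j < C, μ.borderCol j = q j := by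
    intro j hj
    rw [borderCol, hcol j hj, hR0]
    have := hge j hj
    have := hlt j hj
    omega
  refine ⟨μ, ?_, ?_⟩
  · rw [hμ]
    have := hlt 0 hCpos
    omega
  · have hlen : μ.borderWord.length = l.length := by rw [length_borderWord, hR0, hC0]; omega
    refine List.ext_getElem hlen fun x h1 h2 => ?_
    have key : μ.borderWord[x]? = some true ↔ l[x]? = some true := by
      rw [borderWord_eq_true, ← wordBoard.mem_cols, ← hH, himg, hC0]
      exact exists_congr fun j => and_congr_right fun hj => by rw [hbc j hj]
    rw [List.getElem?_eq_getElem h1, List.getElem?_eq_getElem h2, Option.some.injEq,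
      Option.some.injEq] at key
    exact Bool.eq_iff_iff.2 key

theorem border_eq_succ_iff {i j : ℕ} (h : (i, j) ∈ μ) :
    μ.borderRow i = μ.borderCol j + 1 ↔ (i + 1, j) ∉ μ ∧ (i, j + 1) ∉ μ := by
  have h1 := mem_iff_lt_rowLen.1 h
  have h2 := mem_iff_lt_colLen.1 h
  have h3 := μ.colLen_anti 0 j (Nat.zero_le _)
  rw [mem_iff_lt_colLen, mem_iff_lt_rowLen, borderRow, borderCol]
  omega

/-- In a filling of a Young diagram every row has a leftmost point, every column has a topmost
point, and the root is the only point that is both. -/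
theorem card_add_one_of_isFilling {P : Finset (ℕ × ℕ)} (h : μ.board.IsFilling P) :
    P.card + 1 = μ.colLen 0 + μ.rowLen 0 := by
  classical
  set T := P.filter fun c => ∀ i < c.1, (i, c.2) ∉ P with hT
  set S := P.filter fun c => ∀ j < c.2, (c.1, j) ∉ P with hS
  have hmT : ∀ i j, (i, j) ∈ T ↔ (i, j) ∈ P ∧ ∀ i' < i, (i', j) ∉ P := fun i j => by
    rw [hT, Finset.mem_filter]
  have hmS : ∀ i j, (i, j) ∈ S ↔ (i, j) ∈ P ∧ ∀ j' < j, (i, j') ∉ P := fun i j => by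
    rw [hS, Finset.mem_filter]
  have hTc : T.card = μ.rowLen 0 := by
    rw [← Finset.card_range (μ.rowLen 0)]
    refine Finset.card_bij (fun c _ => c.2) ?_ ?_ ?_
    · rintro ⟨i, j⟩ hc
      exact (h.mem _ _ ((hmT _ _).1 hc).1).2.1
    · rintro ⟨i, j⟩ hc ⟨i', j'⟩ hc' (rfl : j = j')
      obtain ⟨h1, h2⟩ := (hmT _ _).1 hc
      obtain ⟨h3, h4⟩ := (hmT _ _).1 hc'
      rcases lt_trichotomy i i' with hlt | rfl | hlt
      · exact absurd h1 (h4 _ hlt)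
      · rfl
      · exact absurd h3 (h2 _ hlt)
    · intro j hj
      have hex := h.col j hj
      exact ⟨(Nat.find hex, j), (hmT _ _).2 ⟨Nat.find_spec hex, fun i hi => Nat.find_min hex hi⟩,
        rfl⟩
  have hSc : S.card = μ.colLen 0 := by
    rw [← Finset.card_range (μ.colLen 0)]
    refine Finset.card_bij (fun c _ => c.1) ?_ ?_ ?_
    · rintro ⟨i, j⟩ hc
      exact (h.mem _ _ ((hmS _ _).1 hc).1).1
    · rintro ⟨i, j⟩ hc ⟨i', j'⟩ hc' (rfl : i = i')
      obtain ⟨h1, h2⟩ := (hmS _ _).1 hc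
      obtain ⟨h3, h4⟩ := (hmS _ _).1 hc'
      rcases lt_trichotomy j j' with hlt | rfl | hlt
      · exact absurd h1 (h4 _ hlt)
      · rfl
      · exact absurd h3 (h2 _ hlt)
    · intro i hi
      have hex := h.row i hi
      exact ⟨(i, Nat.find hex), (hmS _ _).2 ⟨Nat.find_spec hex, fun i hi => Nat.find_min hex hi⟩,
        rfl⟩
  have hU : T ∪ S = P := by
    refine Finset.Subset.antisymm (Finset.union_subset (Finset.filter_subset _ _)
      (Finset.filter_subset _ _)) ?_
    rintro ⟨i, j⟩ hij
    rw [Finset.mem_union, hmT, hmS]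
    by_cases hr : (i, j) = (0, 0)
    · obtain ⟨rfl, rfl⟩ := Prod.mk.inj hr
      exact Or.inl ⟨hij, by simp⟩
    · rcases h.xor i j hij hr with h1 | h1
      · exact Or.inr ⟨hij, fun j' hj' hm => h1.2 ⟨j', hj', hm⟩⟩
      · exact Or.inl ⟨hij, fun i' hi' hm => h1.2 ⟨i', hi', hm⟩⟩
  have hI : T ∩ S = {(0, 0)} := by
    ext ⟨i, j⟩
    rw [Finset.mem_inter, hmT, hmS, Finset.mem_singleton]
    constructor
    · rintro ⟨⟨hij, h1⟩, -, h2⟩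
      by_contra hr
      rcases h.xor i j hij hr with h3 | h3
      · obtain ⟨i', h4, h5⟩ := h3.1
        exact h1 i' h4 h5
      · obtain ⟨i', h4, h5⟩ := h3.1
        exact h2 i' h4 h5
    · intro hr
      obtain ⟨rfl, rfl⟩ := Prod.mk.inj hr
      exact ⟨⟨h.root, by simp⟩, h.root, by simp⟩
  have := Finset.card_union_add_card_inter T S
  rw [hU, hI, Finset.card_singleton] at this
  omega

end YoungDiagram

/-! ### Tableaux as fillings, and their non-occupied corners sorted by border word -/

namespace TreeLikeTableau

theorem isFilling (T : TreeLikeTableau) : T.diagram.board.IsFilling T.points where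
  mem i j hij := by
    have h : (i, j) ∈ T.diagram := T.points_subset hij
    refine ⟨Finset.mem_range.2 ?_, Finset.mem_range.2 ?_, h⟩
    · exact YoungDiagram.mem_iff_lt_colLen.1
        (T.diagram.up_left_mem le_rfl (Nat.zero_le j) h)
    · exact YoungDiagram.mem_iff_lt_rowLen.1
        (T.diagram.up_left_mem (Nat.zero_le i) le_rfl h)
  root := T.root_mem
  xor := T.above_xor_left
  row i hi := T.row_pointed i 0 (YoungDiagram.mem_iff_lt_colLen.2 (Finset.mem_range.1 hi))
  col j hj := T.col_pointed 0 j (YoungDiagram.mem_iff_lt_rowLen.2 (Finset.mem_range.1 hj))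

/-- The tree-like tableau given by a filling of a Young diagram. -/
def ofFilling (μ : YoungDiagram) (P : Finset (ℕ × ℕ)) (h : μ.board.IsFilling P) :
    TreeLikeTableau where
  diagram := μ
  points := P
  points_subset := fun c hc => (h.mem c.1 c.2 hc).2.2
  root_mem := h.root
  above_xor_left := h.xor
  row_pointed i j hij := h.row i (Finset.mem_range.2 (YoungDiagram.mem_iff_lt_colLen.1
    (μ.up_left_mem le_rfl (Nat.zero_le j) hij)))
  col_pointed i j hij := h.col j (Finset.mem_range.2 (YoungDiagram.mem_iff_lt_rowLen.1
    (μ.up_left_mem (Nat.zero_le i) le_rfl hij)))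

theorem zero_mem_diagram (T : TreeLikeTableau) : (0, 0) ∈ T.diagram := T.points_subset T.root_mem

theorem size_add_one (T : TreeLikeTableau) : T.size + 1 = T.diagram.borderWord.length := by
  rw [YoungDiagram.length_borderWord]
  exact YoungDiagram.card_add_one_of_isFilling T.isFilling

end TreeLikeTableau

namespace TreeLikeTableau

/-- The non-occupied corners whose border steps follow the prefix `u` and precede the suffix `v`
of the border path. -/
def cornersAt (u v : List Bool) : Set (TreeLikeTableau × (ℕ × ℕ)) :=
  {x | x.1.IsNonOccupiedCorner x.2 ∧ x.1.diagram.borderWord = u ++ true :: false :: v ∧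
    x.1.diagram.borderCol x.2.2 = u.length}

theorem bijOn_points {μ : YoungDiagram} {u v : List Bool} {i j : ℕ} (hi : i < μ.colLen 0)
    (hw : μ.borderWord = u ++ true :: false :: v) (hri : μ.borderRow i = u.length + 1)
    (hcj : μ.borderCol j = u.length) :
    Set.BijOn (fun x => x.1.points) (cornersAt u v) (μ.board.eraseCell i j).fillings := by
  have hij : (i, j) ∈ μ := by
    rw [YoungDiagram.mem_iff_border hi, hri, hcj]
    exact Nat.lt_succ_self _
  have hco := (YoungDiagram.border_eq_succ_iff hij).1 (by rw [hri, hcj])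
  -- The border word determines the diagram, the position `u.length` the column of the corner, and
  -- the next position its row.
  have key : ∀ x ∈ cornersAt u v, x.1.diagram = μ ∧ x.2 = (i, j) := by
    rintro ⟨T, a, b⟩ ⟨⟨⟨h1, h2⟩, -⟩, h3, h4⟩
    have hμ : T.diagram = μ := YoungDiagram.borderWord_injective (h3.trans hw.symm)
    refine ⟨hμ, ?_⟩
    have h5 := (YoungDiagram.border_eq_succ_iff h1).2 h2
    simp only at h1 h4 h5
    rw [hμ] at h1 h4 h5
    have ha : a < μ.colLen 0 :=
      YoungDiagram.mem_iff_lt_colLen.1 (μ.up_left_mem le_rfl (Nat.zero_le b) h1)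
    rw [μ.borderCol_strictMono.injective (h4.trans hcj.symm)]
    rw [h4, ← hri] at h5
    rw [μ.borderRow_injOn ha hi h5]
  refine Set.BijOn.mk ?_ ?_ ?_
  · intro x hx
    obtain ⟨h1, h2⟩ := key x hx
    rw [Board.fillings_eraseCell]
    refine ⟨h1 ▸ x.1.isFilling, ?_⟩
    rw [← h2]
    exact hx.1.2
  · intro x hx y hy hxy
    obtain ⟨h1, h2⟩ := key x hx
    obtain ⟨h3, h4⟩ := key y hy
    exact Prod.ext (TreeLikeTableau.ext (h1.trans h3.symm) hxy) (h2.trans h4.symm)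
  · intro P hP
    rw [Board.fillings_eraseCell] at hP
    exact ⟨(ofFilling μ P hP.1, (i, j)), ⟨⟨⟨hij, hco⟩, hP.2⟩, hw, hcj⟩, rfl⟩

theorem cornersAt_finite_and_ncard (u v : List Bool) : (cornersAt u v).Finite ∧
    (cornersAt u v).ncard =
      ((wordBoard (u ++ true :: false :: v)).eraseCell (u.length + 1) u.length).count := by
  set l := u ++ true :: false :: v with hl
  -- Any other word is the border of no tableau, and the root of its board lies off the board, so
  -- both sides vanish.
  by_cases h : l.head? = some true ∧ l.getLast? = some false
  · obtain ⟨μ, h0, hw⟩ := YoungDiagram.exists_borderWord_eq h.1 h.2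
    obtain ⟨j, hj, hcj⟩ := YoungDiagram.borderWord_eq_true.1
      (show μ.borderWord[u.length]? = some true by rw [hw, hl]; simp)
    obtain ⟨i, hi, hri⟩ := YoungDiagram.borderWord_eq_false.1
      (show μ.borderWord[u.length + 1]? = some false by rw [hw, hl]; simp)
    have hb := bijOn_points hi (hw.trans hl) hri hcj
    refine ⟨hb.finite_iff_finite.2 (Board.finite_fillings _), ?_⟩
    rw [hb.ncard_eq, ← hw, ← hri, ← hcj]
    exact ((YoungDiagram.board_iso h0).eraseCell (Finset.mem_range.2 hi)
      (Finset.mem_range.2 hj)).count_eq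
      (Finset.mem_range.2 (YoungDiagram.mem_iff_lt_colLen.1 h0))
      (Finset.mem_range.2 (YoungDiagram.mem_iff_lt_rowLen.1 h0))
  · have he : cornersAt u v = ∅ := by
      refine Set.eq_empty_iff_forall_notMem.2 fun x hx => h ?_
      rw [hl, ← hx.2.1]
      exact ⟨YoungDiagram.head?_borderWord x.1.zero_mem_diagram,
        YoungDiagram.getLast?_borderWord x.1.zero_mem_diagram⟩
    have hc : ((wordBoard l).eraseCell (u.length + 1) u.length).count = 0 := by
      refine Board.count_eq_zero fun P hP => h ?_
      rw [List.head?_eq_getElem?, List.getLast?_eq_getElem?]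
      exact ⟨wordBoard.mem_cols.1 hP.root_mem.2.1, wordBoard.mem_rows.1 hP.root_mem.1⟩
    rw [hc, he]
    simp

/-- The border word has length one more than the size, here m + 2. Removing the two letters of the
corner leaves total length m for prefix and suffix. -/
theorem nonOccupiedCorners_ofSize (m : ℕ) : nonOccupiedCorners (ofSize (m + 1)) =
    ⋃ p ∈ (Finset.HasAntidiagonal.antidiagonal m).sigma fun p => words p.1 ×ˢ words p.2,
      cornersAt p.2.1 p.2.2 := by
  ext ⟨T, i, j⟩
  simp only [Set.mem_iUnion, Finset.mem_sigma, Finset.HasAntidiagonal.mem_antidiagonal,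
    Finset.mem_product, mem_words, exists_prop, Sigma.exists, Prod.exists]
  have hs := T.size_add_one
  constructor
  · rintro ⟨hT, hc⟩
    have hT : T.size = m + 1 := hT
    have hij : (i, j) ∈ T.diagram := hc.1.1
    have hb := (YoungDiagram.border_eq_succ_iff hij).2 hc.1.2
    have hj : j < T.diagram.rowLen 0 :=
      YoungDiagram.mem_iff_lt_rowLen.1 (T.diagram.up_left_mem (Nat.zero_le i) le_rfl hij)
    have hi : i < T.diagram.colLen 0 :=
      YoungDiagram.mem_iff_lt_colLen.1 (T.diagram.up_left_mem le_rfl (Nat.zero_le j) hij)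
    set k := T.diagram.borderCol j with hk
    have h1 : T.diagram.borderWord[k]? = some true :=
      YoungDiagram.borderWord_eq_true.2 ⟨j, hj, rfl⟩
    have h2 : T.diagram.borderWord[k + 1]? = some false :=
      YoungDiagram.borderWord_eq_false.2 ⟨i, hi, hb⟩
    obtain ⟨h3, h4⟩ := List.getElem?_eq_some_iff.1 h1
    obtain ⟨h5, h6⟩ := List.getElem?_eq_some_iff.1 h2
    have h7 : T.diagram.borderWord = T.diagram.borderWord.take k ++
        true :: false :: T.diagram.borderWord.drop (k + 2) := by
      conv_lhs => rw [← List.take_append_drop k T.diagram.borderWord,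
        List.drop_eq_getElem_cons h3, List.drop_eq_getElem_cons h5, h4, h6]
    have h8 : (T.diagram.borderWord.take k).length = k := by
      rw [List.length_take]
      omega
    refine ⟨k, m - k, _, _, ⟨by omega, h8, ?_⟩, hc, h7, h8.symm⟩
    rw [List.length_drop]
    omega
  · rintro ⟨a, b, u, v, ⟨hab, hu, hv⟩, hc, h1, -⟩
    refine ⟨?_, hc⟩
    simp only at h1
    rw [h1] at hs
    simp only [List.length_append, List.length_cons] at hs
    change T.size = m + 1
    omega

theorem ncard_nonOccupiedCorners (m : ℕ) : (nonOccupiedCorners (ofSize (m + 1))).Finite ∧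
    (nonOccupiedCorners (ofSize (m + 1))).ncard =
      ∑ p ∈ Finset.HasAntidiagonal.antidiagonal m, ∑ u ∈ words p.1, ∑ v ∈ words p.2,
        ((wordBoard (u ++ true :: false :: v)).eraseCell (u.length + 1) u.length).count := by
  classical
  rw [nonOccupiedCorners_ofSize]
  set I := (Finset.HasAntidiagonal.antidiagonal m).sigma fun p => words p.1 ×ˢ words p.2 with hI
  have hfin := fun u v => (cornersAt_finite_and_ncard u v).1
  refine ⟨Set.Finite.biUnion I.finite_toSet fun p _ => hfin _ _, ?_⟩
  have h1 : (⋃ p ∈ I, cornersAt p.2.1 p.2.2) =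
      ((I.biUnion fun p => (hfin p.2.1 p.2.2).toFinset : Finset _) : Set _) := by
    ext x
    simp
  rw [h1, Set.ncard_coe_finset, Finset.card_biUnion, hI, Finset.sum_sigma]
  · refine Finset.sum_congr rfl fun p _ => ?_
    rw [Finset.sum_product]
    refine Finset.sum_congr rfl fun u _ => Finset.sum_congr rfl fun v _ => ?_
    rw [← (cornersAt_finite_and_ncard u v).2, Set.ncard_eq_toFinset_card _ (hfin u v)]
  · rintro ⟨⟨a, b⟩, u, v⟩ hp ⟨⟨a', b'⟩, u', v'⟩ hp' hne
    simp only [hI, Finset.mem_coe, Finset.mem_sigma, Finset.mem_product, mem_words] at hp hp'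
    simp only [Set.Finite.disjoint_toFinset]
    refine Set.disjoint_left.2 fun x hx hx' => hne ?_
    -- The position of the corner in the border word fixes where the word is cut, hence both prefix
    -- and suffix.
    have h2 := hx.2.2.symm.trans hx'.2.2
    have h3 := hx.2.1.symm.trans hx'.2.1
    obtain ⟨rfl, h4⟩ := List.append_inj h3 h2
    simp only [List.cons.injEq, true_and] at h4
    subst h4
    obtain ⟨-, rfl, rfl⟩ := hp
    obtain ⟨-, rfl, rfl⟩ := hp'
    rfl

end TreeLikeTableau

/-! ### Evaluation of the total -/

namespace wordBoard

/-- The function `innerCount` as an element of the exclusion module. -/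
noncomputable def innerCountElement : exclusionModule :=
  ⟨fun w => innerCount w, fun u v => by simp only [innerCount_append]; push_cast; ring,
    fun v => by simp only [innerCount_false_cons]⟩

theorem shift_innerCountElement :
    exclusionModule.shift true innerCountElement = innerCountElement := by
  ext w
  rw [exclusionModule.shift_apply]
  simp only [innerCountElement, innerCount_append_true]

/-- Only prefixes beginning with D and suffixes ending with E keep the root on the board. Stripping
these two letters and exchanging DE for ED leaves an inner word. -/
theorem sum_count_eraseCell_succ (i j : ℕ) :
    ∑ u ∈ words (i + 1), ∑ v ∈ words (j + 1),
        ((wordBoard (u ++ true :: false :: v)).eraseCell (u.length + 1) u.length).count =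
      ∑ u ∈ words i, ∑ v ∈ words j, innerCount (u ++ false :: true :: v) := by
  have h1 : ∀ u v, ((wordBoard (false :: u ++ true :: false :: v)).eraseCell
      ((false :: u).length + 1) (false :: u).length).count = 0 := by
    intro u v
    refine Board.count_eq_zero fun P hP => ?_
    have : 0 ∈ (wordBoard (false :: u ++ true :: false :: v)).cols := hP.root_mem.2.1
    simp [mem_cols] at this
  have h2 : ∀ u v, ((wordBoard (u ++ true :: false :: (v ++ [true]))).eraseCell
      (u.length + 1) u.length).count = 0 := by
    intro u v
    refine Board.count_eq_zero fun P hP => ?_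
    have := mem_rows.1 (show _ ∈ (wordBoard _).rows from hP.root_mem.1)
    change (u ++ true :: false :: (v ++ [true]))[(u ++ true :: false :: (v ++ [true])).length - 1]?
      = _ at this
    rw [← List.getLast?_eq_getElem?] at this
    simp [List.getLast?_append, List.getLast?_cons] at this
  rw [sum_words_succ]
  simp only [h1, Finset.sum_const_zero, add_zero]
  refine Finset.sum_congr rfl fun u _ => ?_
  rw [sum_words_succ']
  simp only [h2, Finset.sum_const_zero, zero_add]
  refine Finset.sum_congr rfl fun v _ => ?_
  rw [count_eraseCell (by simp) (by simp), innerCount]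
  simp

theorem sum_count_eraseCell_zero_left (j : ℕ) :
    ∑ u ∈ words 0, ∑ v ∈ words j,
      ((wordBoard (u ++ true :: false :: v)).eraseCell (u.length + 1) u.length).count = 0 := by
  simp [words, count_eraseCell_of_head]

theorem sum_count_eraseCell_zero_right (i : ℕ) :
    ∑ u ∈ words i, ∑ v ∈ words 0,
      ((wordBoard (u ++ true :: false :: v)).eraseCell (u.length + 1) u.length).count = 0 := by
  simp [words, count_eraseCell_of_last]

end wordBoard

theorem mainTheorem4 (n : ℕ) :
    (3 ≤ n →
      (TreeLikeTableau.nonOccupiedCorners (TreeLikeTableau.ofSize n)).Finite ∧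
      ((TreeLikeTableau.nonOccupiedCorners (TreeLikeTableau.ofSize n)).ncard : ℚ) =
        (n ! : ℚ) * (((n : ℚ) - 2) / 6)) ∧
    (n = 1 ∨ n = 2 →
      (TreeLikeTableau.nonOccupiedCorners (TreeLikeTableau.ofSize n)).Finite ∧
      (TreeLikeTableau.nonOccupiedCorners (TreeLikeTableau.ofSize n)).ncard = 0) := by
  constructor
  · intro hn
    obtain ⟨m, rfl⟩ : ∃ m, n = m + 2 + 1 := ⟨n - 3, by omega⟩
    obtain ⟨h1, h2⟩ := TreeLikeTableau.ncard_nonOccupiedCorners (m + 2)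
    refine ⟨h1, ?_⟩
    have h3 := exclusionModule.sum_words_false_true wordBoard.shift_innerCountElement m
    -- The two ends of the antidiagonal, with empty prefix or empty suffix, contribute nothing: such
    -- a corner is the only cell of its row or of its column and must be occupied.
    rw [h2, Finset.Nat.sum_antidiagonal_succ, Finset.Nat.sum_antidiagonal_succ',
      wordBoard.sum_count_eraseCell_zero_left, wordBoard.sum_count_eraseCell_zero_right]
    simp only [wordBoard.sum_count_eraseCell_succ, zero_add]
    push_cast
    simp only [wordBoard.innerCountElement, wordBoard.innerCount_nil] at h3
    rw [h3]
    push_cast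
    ring
  · rintro (rfl | rfl)
    · obtain ⟨h1, h2⟩ := TreeLikeTableau.ncard_nonOccupiedCorners 0
      refine ⟨h1, h2.trans ?_⟩
      rw [Finset.Nat.antidiagonal_zero, Finset.sum_singleton]
      exact wordBoard.sum_count_eraseCell_zero_left 0
    · obtain ⟨h1, h2⟩ := TreeLikeTableau.ncard_nonOccupiedCorners 1
      refine ⟨h1, h2.trans ?_⟩
      rw [Finset.Nat.sum_antidiagonal_succ, Finset.Nat.antidiagonal_zero, Finset.sum_singleton]
      simp only [wordBoard.sum_count_eraseCell_zero_left, wordBoard.sum_count_eraseCell_zero_right,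
        zero_add]
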